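/- Let $n\geq 2$ and let $\Omega_n=\{1<2<\cdots<n\}$. Partial transformations of $\Omega_n$ are composed from left to right. Let $\mathcal{PIO}_n$ (respectively $\mathcal{PIM}_n$) be the monoid of all order-preserving (respectively order-preserving or order-reversing) partial transformations of $\Omega_n$ whose domain and image are both intervals of $\Omega_n$ (the empty set is an interval). For $1\leq i\leq n-1$ let $$a_i=\begin{pmatrix}1&\cdots&i&i+1&\cdots&n\\1&\cdots&i&i&\cdots&n-1\end{pmatrix},\qquad b_i=\begin{pmatrix}1&\cdots&i&i+1&\cdots&n\\2&\cdots&i+1&i+1&\cdots&n\end{pmatrix},$$ let $e_i$ be the identity map on $\{1,\dots,i\}$, $f_{i+1}$ the identity map on $\{i+1,\dots,n\}$, and let $h$ be the permutation $x\mapsto n+1-x$. Put $X=\{a_i,b_i,e_i,f_{i+1}\mid 1\leq i\leq n-1\}$ and $D=X\cup\{h\}$, used both as sets of transformations and as alphabets. A monoid $M$ is defined by a presentation $\langle A\mid R\rangle$ on generators $A\subseteq M$ if there is an isomorphism from $A^*/{\sim_R}$ onto $M$ that sends the class of each letter to the generator it denotes, where $\sim_R$ is the congruence on $A^*$ generated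 by $R$. For a set $R'$ of relations over $X$, let $\widehat R$ be $R'$ together with the relations $$(N_0)\ h^2=1,\qquad (N_1)\ ha_i=b_{n-i}h,\qquad (N_1')\ he_i=f_{n-i+1}h\quad(1\leq i\leq n-1),\qquad (N_2)\ a_1^{n-1}h=b_{n-1}^{n-1}.$$ **Theorem.** The alphabet $D$ has $4n-3$ letters, and they denote pairwise distinct transformations. If $\langle X\mid R'\rangle$ is any presentation that defines $\mathcal{PIO}_n$ on the generators $X$, then $\mathcal{PIM}_n$ is defined by $\langle D\mid\widehat R\rangle$, and $|\widehat R|=|R'|+2n$. Moreover, $\mathcal{PIO}_n$ is defined by a presentation $\langle X\mid R'\rangle$ with exactly $5n^2+3n-10$ relations, for which, therefore, $\langle D\mid\widehat R\rangle$ is a presentation of $\mathcal{PIM}_n$ on $4n-3$ generators with exactly $5n^2+5n-10$ relations; for example, one can take for $R'$ the following relations (in which $1\leq i\leq n-1$ unless another range is given): 1. $a_ia_j=a_{j+1}a_i$ and $a_ib_j=b_{j+1}a_{i+1}$ and $a_ie_j=e_{j+1}a_i$ for $1\leq i\leq j\leq n-2$; 2. $b_ib_j=b_{j-1}b_i$ and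 $b_ie_j=e_{j-1}b_i$ for $2\leq j\leq i\leq n-1$; 3. $a_if_j=f_{j+1}a_i$ for $1\leq i<j\leq n-1$, and $b_if_j=f_{j-1}b_i$ for $3\leq j\leq i+1\leq n$; 4. $a_ia_{n-1}=a_i$, $\ b_ib_1=b_i$, $\ a_ib_{n-1}=b_i$, $\ b_ia_1=a_i$, $\ a_ie_{n-1}=a_i$, $\ b_if_2=b_i$, $\ e_ia_i=e_i$, $\ f_{i+1}b_i=f_{i+1}$; 5. $e_ie_j=e_i$ for $1\leq i\leq j\leq n-1$, and $f_jf_i=f_j$ for $2\leq i\leq j\leq n$; 6. $e_{i+1}e_i=e_i$, $\ f_{i+1}f_{i+2}=f_{i+2}$, $\ a_{i+1}e_i=e_i$, $\ b_if_{i+2}=f_{i+2}$ for $1\leq i\leq n-2$; 7. $f_je_i=e_if_j$ for $2\leq j\leq i+1\leq n$; 8. $a_if_n=f_ne_1$, $\ b_ie_1=f_ne_1$, $\ e_if_{i+1}=a_if_n$; 9. $a_1f_ne_1=f_ne_1$, $\ b_{n-1}f_ne_1=f_ne_1$. -/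

import Mathlib

/-! Partial transformations of a finite chain, composed from left to right. -/

/-- The chain `1 < 2 < ⋯ < n`. -/
abbrev Chain (n : ℕ) : Type := {x : ℕ // 1 ≤ x ∧ x ≤ n}

/-- Partial transformations of the chain; `α x = none` means that `x` is not in the domain. -/
abbrev PT (n : ℕ) : Type := Chain n → Option (Chain n)

namespace PT

variable {n : ℕ}

/-- The product `α * β` is "first `α`, then `β`". -/
instance : Monoid (PT n) where
  one := fun x => some x
  mul α β := fun x => (α x).bind β
  one_mul _ := rfl
  mul_one α := by
    funext x
    change (α x).bind some = α x
    simp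
  mul_assoc α β γ := by
    funext x
    change ((α x).bind β).bind γ = (α x).bind fun y => (β y).bind γ
    exact Option.bind_assoc (α x) β γ

theorem one_apply (x : Chain n) : (1 : PT n) x = some x := rfl

theorem mul_apply (α β : PT n) (x : Chain n) : (α * β) x = (α x).bind β := rfl

theorem mul_eq_some {α β : PT n} {x z : Chain n} :
    (α * β) x = some z ↔ ∃ y, α x = some y ∧ β y = some z := by
  rw [mul_apply]
  exact Option.bind_eq_some_iff

def Dom (α : PT n) : Set (Chain n) := {x | ∃ y, α x = some y}

def Im (α : PT n) : Set (Chain n) := {y | ∃ x, α x = some y}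

def OrderPreserving (α : PT n) : Prop :=
  ∀ x y x' y' : Chain n, α x = some x' → α y = some y' → x < y → x' ≤ y'

def OrderReversing (α : PT n) : Prop :=
  ∀ x y x' y' : Chain n, α x = some x' → α y = some y' → x < y → y' ≤ x'

/-- Domain and image are intervals, i.e. `x ≤ y ≤ z` with `x`, `z` in the set forces `y` in it
(the empty set is an interval). -/
def HasIntervals (α : PT n) : Prop := α.Dom.OrdConnected ∧ α.Im.OrdConnected

theorem OrderPreserving.le {α : PT n} (h : α.OrderPreserving) {x y x' y' : Chain n}
    (hx : α x = some x') (hy : α y = some y') (hxy : x ≤ y) : x' ≤ y' := by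
  rcases hxy.lt_or_eq with hlt | rfl
  · exact h x y x' y' hx hy hlt
  · rw [hx] at hy
    exact (Option.some.inj hy).le

theorem OrderReversing.le {α : PT n} (h : α.OrderReversing) {x y x' y' : Chain n}
    (hx : α x = some x') (hy : α y = some y') (hxy : x ≤ y) : y' ≤ x' := by
  rcases hxy.lt_or_eq with hlt | rfl
  · exact h x y x' y' hx hy hlt
  · rw [hx] at hy
    exact (Option.some.inj hy).ge

theorem OrderPreserving.mul {α β : PT n} (hα : α.OrderPreserving) (hβ : β.OrderPreserving) :
    (α * β).OrderPreserving := by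
  intro x y x' y' hx hy hxy
  obtain ⟨u, hu, hux⟩ := mul_eq_some.1 hx
  obtain ⟨v, hv, hvy⟩ := mul_eq_some.1 hy
  exact hβ.le hux hvy (hα.le hu hv hxy.le)

theorem monotone_mul {α β : PT n} (hα : α.OrderPreserving ∨ α.OrderReversing)
    (hβ : β.OrderPreserving ∨ β.OrderReversing) :
    (α * β).OrderPreserving ∨ (α * β).OrderReversing := by
  rcases hα with hα | hα <;> rcases hβ with hβ | hβ
  · exact Or.inl (hα.mul hβ)
  · right
    intro x y x' y' hx hy hxy
    obtain ⟨u, hu, hux⟩ := mul_eq_some.1 hx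
    obtain ⟨v, hv, hvy⟩ := mul_eq_some.1 hy
    exact hβ.le hux hvy (hα.le hu hv hxy.le)
  · right
    intro x y x' y' hx hy hxy
    obtain ⟨u, hu, hux⟩ := mul_eq_some.1 hx
    obtain ⟨v, hv, hvy⟩ := mul_eq_some.1 hy
    exact hβ.le hvy hux (hα.le hu hv hxy.le)
  · left
    intro x y x' y' hx hy hxy
    obtain ⟨u, hu, hux⟩ := mul_eq_some.1 hx
    obtain ⟨v, hv, hvy⟩ := mul_eq_some.1 hy
    exact hβ.le hvy hux (hα.le hu hv hxy.le)

theorem HasIntervals.mul {α β : PT n} (mα : α.OrderPreserving ∨ α.OrderReversing)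
    (mβ : β.OrderPreserving ∨ β.OrderReversing) (hα : α.HasIntervals) (hβ : β.HasIntervals) :
    (α * β).HasIntervals := by
  constructor
  · refine ⟨fun x hx z hz y hy => ?_⟩
    obtain ⟨x', hx⟩ := hx
    obtain ⟨z', hz⟩ := hz
    obtain ⟨u, hu, hux⟩ := mul_eq_some.1 hx
    obtain ⟨w, hw, hwz⟩ := mul_eq_some.1 hz
    obtain ⟨v, hv⟩ := hα.1.out ⟨u, hu⟩ ⟨w, hw⟩ hy
    have hvβ : v ∈ β.Dom := by
      rcases mα with m | m
      · exact hβ.1.out ⟨x', hux⟩ ⟨z', hwz⟩ ⟨m.le hu hv hy.1, m.le hv hw hy.2⟩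
      · exact hβ.1.out ⟨z', hwz⟩ ⟨x', hux⟩ ⟨m.le hv hw hy.2, m.le hu hv hy.1⟩
    obtain ⟨y', hy'⟩ := hvβ
    exact ⟨y', mul_eq_some.2 ⟨v, hv, hy'⟩⟩
  · refine ⟨fun x' hx z' hz y' hy => ?_⟩
    obtain ⟨x, hx⟩ := hx
    obtain ⟨z, hz⟩ := hz
    obtain ⟨u, hu, hux⟩ := mul_eq_some.1 hx
    obtain ⟨w, hw, hwz⟩ := mul_eq_some.1 hz
    obtain ⟨v, hv⟩ := hβ.2.out ⟨u, hux⟩ ⟨w, hwz⟩ hy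
    rcases hy.1.eq_or_lt with rfl | hxy
    · exact ⟨x, hx⟩
    rcases hy.2.eq_or_lt with rfl | hyz
    · exact ⟨z, hz⟩
    have hvα : v ∈ α.Im := by
      rcases mβ with m | m
      · have h1 : u ≤ v := by
          by_contra hc
          exact absurd (m.le hv hux (le_of_not_ge hc)) (not_le_of_gt hxy)
        have h2 : v ≤ w := by
          by_contra hc
          exact absurd (m.le hwz hv (le_of_not_ge hc)) (not_le_of_gt hyz)
        exact hα.2.out ⟨x, hu⟩ ⟨z, hw⟩ ⟨h1, h2⟩
      · have h1 : v ≤ u := by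
          by_contra hc
          exact absurd (m.le hux hv (le_of_not_ge hc)) (not_le_of_gt hxy)
        have h2 : w ≤ v := by
          by_contra hc
          exact absurd (m.le hv hwz (le_of_not_ge hc)) (not_le_of_gt hyz)
        exact hα.2.out ⟨z, hw⟩ ⟨x, hu⟩ ⟨h2, h1⟩
    obtain ⟨y, hy⟩ := hvα
    exact ⟨y, mul_eq_some.2 ⟨v, hy, hv⟩⟩

theorem orderPreserving_one : (1 : PT n).OrderPreserving := by
  intro x y x' y' hx hy hxy
  obtain rfl := Option.some.inj hx
  obtain rfl := Option.some.inj hy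
  exact hxy.le

theorem hasIntervals_one : (1 : PT n).HasIntervals :=
  ⟨⟨fun _ _ _ _ y _ => ⟨y, rfl⟩⟩, ⟨fun _ _ _ _ y _ => ⟨y, rfl⟩⟩⟩

end PT

/-- Order-preserving partial transformations whose domain and image are intervals. -/
def PIOn (n : ℕ) : Submonoid (PT n) where
  carrier := {α | α.OrderPreserving ∧ α.HasIntervals}
  one_mem' := ⟨PT.orderPreserving_one, PT.hasIntervals_one⟩
  mul_mem' hα hβ := ⟨hα.1.mul hβ.1, hα.2.mul (Or.inl hα.1) (Or.inl hβ.1) hβ.2⟩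

/-- Monotone (order-preserving or order-reversing) partial transformations whose domain and
image are intervals. -/
def PIMn (n : ℕ) : Submonoid (PT n) where
  carrier := {α | (α.OrderPreserving ∨ α.OrderReversing) ∧ α.HasIntervals}
  one_mem' := ⟨Or.inl PT.orderPreserving_one, PT.hasIntervals_one⟩
  mul_mem' hα hβ := ⟨PT.monotone_mul hα.1 hβ.1, hα.2.mul hα.1 hβ.1 hβ.2⟩

/-! Monoid presentations. -/

/-- A set of relations `u = v` over the alphabet `A`. -/
abbrev Relations (A : Type) : Type := Set (FreeMonoid A × FreeMonoid A)

/-- The submonoid `S` of `M` is defined by the presentation `⟨A | R⟩`, the letter `x` standing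
for the element `φ x`: the quotient of the free monoid on `A` by the congruence generated by `R`
is isomorphic to `S`, through an isomorphism that sends the class of each letter `x` to `φ x`. -/
def DefinedBy {M A : Type} [Monoid M] (S : Submonoid M) (φ : A → M) (R : Relations A) : Prop :=
  ∃ f : PresentedMonoid (fun u v => (u, v) ∈ R) ≃* S,
    ∀ x : A, (f (PresentedMonoid.of _ x) : M) = φ x

/-! The generators. -/

/-- The alphabet `a_i, b_i, e_i` (`1 ≤ i ≤ n - 1`), `f_j` (`2 ≤ j ≤ n`). -/
inductive PIOLetter (n : ℕ) : Type
  | a (i : ℕ) (hi : 1 ≤ i ∧ i < n)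
  | b (i : ℕ) (hi : 1 ≤ i ∧ i < n)
  | e (i : ℕ) (hi : 1 ≤ i ∧ i < n)
  | f (j : ℕ) (hj : 2 ≤ j ∧ j ≤ n)

/-- The previous alphabet together with the letter `h`. -/
inductive PIMLetter (n : ℕ) : Type
  | of (x : PIOLetter n)
  | h

/-- The transformations denoted by the letters:
`a_i` fixes `1, …, i` and lowers `i + 1, …, n` by one,
`b_i` raises `1, …, i` by one and fixes `i + 1, …, n`,
`e_i` is the identity on `{1, …, i}` and `f_j` the identity on `{j, …, n}`. -/
def PIOLetter.toPT {n : ℕ} : PIOLetter n → PT n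
  | .a i hi => fun x => some (if h : x.1 ≤ i then x else ⟨x.1 - 1, by have := x.2; omega⟩)
  | .b i hi => fun x => some (if h : x.1 ≤ i then ⟨x.1 + 1, by omega⟩ else x)
  | .e i _ => fun x => if x.1 ≤ i then some x else none
  | .f j _ => fun x => if j ≤ x.1 then some x else none

/-- `h` is the reflection `x ↦ n + 1 - x`. -/
def PIMLetter.toPT {n : ℕ} : PIMLetter n → PT n
  | .of x => x.toPT
  | .h => fun x => some ⟨n + 1 - x.1, by have := x.2; omega⟩

/-! A presentation of `PIOn n`. -/

section PIORelations

variable {n : ℕ}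

/-- The one-letter words `a_i`, `b_i`, `e_i`, `f_j`. -/
def wa (i : ℕ) (hi : 1 ≤ i ∧ i < n := by omega) : FreeMonoid (PIOLetter n) :=
  FreeMonoid.of (.a i hi)

def wb (i : ℕ) (hi : 1 ≤ i ∧ i < n := by omega) : FreeMonoid (PIOLetter n) :=
  FreeMonoid.of (.b i hi)

def we (i : ℕ) (hi : 1 ≤ i ∧ i < n := by omega) : FreeMonoid (PIOLetter n) :=
  FreeMonoid.of (.e i hi)

def wf (j : ℕ) (hj : 2 ≤ j ∧ j ≤ n := by omega) : FreeMonoid (PIOLetter n) :=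
  FreeMonoid.of (.f j hj)

/-- An explicit list of relations between the generators of `PIOn n`; the word `f_n e_1` denotes
the empty transformation. -/
inductive PIORel (n : ℕ) : FreeMonoid (PIOLetter n) → FreeMonoid (PIOLetter n) → Prop
  -- full transformations
  | aa (i j : ℕ) (hi : 1 ≤ i) (hij : i ≤ j) (hj : j + 1 < n) :
      PIORel n (wa i * wa j) (wa (j + 1) * wa i)
  | aa_last (i : ℕ) (hi : 1 ≤ i) (hn : i < n) :
      PIORel n (wa i * wa (n - 1)) (wa i)
  | bb (i j : ℕ) (hj : 2 ≤ j) (hij : j ≤ i) (hi : i < n) :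
      PIORel n (wb i * wb j) (wb (j - 1) * wb i)
  | bb_first (i : ℕ) (hi : 1 ≤ i) (hn : i < n) :
      PIORel n (wb i * wb 1) (wb i)
  | ab (i j : ℕ) (hi : 1 ≤ i) (hij : i ≤ j) (hj : j + 1 < n) :
      PIORel n (wa i * wb j) (wb (j + 1) * wa (i + 1))
  | ab_last (i : ℕ) (hi : 1 ≤ i) (hn : i < n) :
      PIORel n (wa i * wb (n - 1)) (wb i)
  | ba_first (i : ℕ) (hi : 1 ≤ i) (hn : i < n) :
      PIORel n (wb i * wa 1) (wa i)
  -- partial identities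
  | ee (i j : ℕ) (hi : 1 ≤ i) (hij : i ≤ j) (hj : j < n) :
      PIORel n (we i * we j) (we i)
  | ee_succ (i : ℕ) (hi : 1 ≤ i) (hn : i + 1 < n) :
      PIORel n (we (i + 1) * we i) (we i)
  | ff (i j : ℕ) (hi : 2 ≤ i) (hij : i ≤ j) (hj : j ≤ n) :
      PIORel n (wf j * wf i) (wf j)
  | ff_succ (i : ℕ) (hi : 2 ≤ i) (hn : i < n) :
      PIORel n (wf i * wf (i + 1)) (wf (i + 1))
  | fe (i j : ℕ) (hj : 2 ≤ j) (hij : j ≤ i + 1) (hi : i < n) :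
      PIORel n (wf j * we i) (we i * wf j)
  | ef_zero (i : ℕ) (hi : 1 ≤ i) (hn : i < n) :
      PIORel n (we i * wf (i + 1)) (wa i * wf n)
  -- full transformations and partial identities
  | ea (i : ℕ) (hi : 1 ≤ i) (hn : i < n) :
      PIORel n (we i * wa i) (we i)
  | fb (i : ℕ) (hi : 1 ≤ i) (hn : i < n) :
      PIORel n (wf (i + 1) * wb i) (wf (i + 1))
  | ae (i j : ℕ) (hi : 1 ≤ i) (hij : i ≤ j) (hj : j + 1 < n) :
      PIORel n (wa i * we j) (we (j + 1) * wa i)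
  | ae_last (i : ℕ) (hi : 1 ≤ i) (hn : i < n) :
      PIORel n (wa i * we (n - 1)) (wa i)
  | ae_pred (i : ℕ) (hi : 2 ≤ i) (hn : i < n) :
      PIORel n (wa i * we (i - 1)) (we (i - 1))
  | bf (i j : ℕ) (hj : 3 ≤ j) (hij : j ≤ i + 1) (hi : i < n) :
      PIORel n (wb i * wf j) (wf (j - 1) * wb i)
  | bf_first (i : ℕ) (hi : 1 ≤ i) (hn : i < n) :
      PIORel n (wb i * wf 2) (wb i)
  | bf_succ (i : ℕ) (hi : 1 ≤ i) (hn : i + 1 < n) :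
      PIORel n (wb i * wf (i + 2)) (wf (i + 2))
  | af (i j : ℕ) (hi : 1 ≤ i) (hij : i < j) (hj : j < n) :
      PIORel n (wa i * wf j) (wf (j + 1) * wa i)
  | af_zero (i : ℕ) (hi : 1 ≤ i) (hn : i < n) :
      PIORel n (wa i * wf n) (wf n * we 1)
  | be (i j : ℕ) (hj : 2 ≤ j) (hij : j ≤ i) (hi : i < n) :
      PIORel n (wb i * we j) (we (j - 1) * wb i)
  | be_zero (i : ℕ) (hi : 1 ≤ i) (hn : i < n) :
      PIORel n (wb i * we 1) (wf n * we 1)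
  | a_zero (hn : 2 ≤ n) :
      PIORel n (wa 1 * (wf n * we 1)) (wf n * we 1)
  | b_zero (hn : 2 ≤ n) :
      PIORel n (wb (n - 1) * (wf n * we 1)) (wf n * we 1)

end PIORelations

/-- The relations above as a set of pairs of words. -/
def PIORelations (n : ℕ) : Relations (PIOLetter n) := {p | PIORel n p.1 p.2}

/-! The relations for `PIMn n`. -/

/-- The relations `N₀`, `N₁`, `N₁'` and `N₂`:
`h² = 1`; `h a_i = b_{n-i} h` and `h e_i = f_{n-i+1} h` for `1 ≤ i ≤ n - 1`;
`a_1^{n-1} h = b_{n-1}^{n-1}`. -/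
inductive NRel (n : ℕ) : FreeMonoid (PIMLetter n) → FreeMonoid (PIMLetter n) → Prop
  | N0 : NRel n (FreeMonoid.of .h * FreeMonoid.of .h) 1
  | N1 (i : ℕ) (hi : 1 ≤ i) (hn : i < n) :
      NRel n (FreeMonoid.of .h * FreeMonoid.of (.of (.a i ⟨hi, hn⟩)))
        (FreeMonoid.of (.of (.b (n - i) (by omega))) * FreeMonoid.of .h)
  | N1' (i : ℕ) (hi : 1 ≤ i) (hn : i < n) :
      NRel n (FreeMonoid.of .h * FreeMonoid.of (.of (.e i ⟨hi, hn⟩)))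
        (FreeMonoid.of (.of (.f (n - i + 1) (by omega))) * FreeMonoid.of .h)
  | N2 (hn : 2 ≤ n) :
      NRel n (FreeMonoid.of (.of (.a 1 (by omega))) ^ (n - 1) * FreeMonoid.of .h)
        (FreeMonoid.of (.of (.b (n - 1) (by omega))) ^ (n - 1))

/-- The relations `R' ∪ N₀ ∪ N₁ ∪ N₁' ∪ N₂` over the larger alphabet. -/
def RHat (n : ℕ) (R' : Relations (PIOLetter n)) : Relations (PIMLetter n) :=
  Prod.map (FreeMonoid.map PIMLetter.of) (FreeMonoid.map PIMLetter.of) '' R' ∪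
    {p | NRel n p.1 p.2}

/-! In the monoid given by the explicit relations, every element is either the zero or the identity
on an interval followed by a product `w` of letters `a_i` and `b_i`, which denotes a full
transformation. Such a product has a normal form determined by that transformation: the letters
`a_k`, for decreasing `k`, that collapse `k + 1` onto `k`, followed by a power of `b_{n-1}`. In
front of it, the identity on `{p, …, q}` can be followed by the transformation moving every point
to the nearest point of `{p, …, q}`, so that only the restriction of `w` to the interval matters;
hence the action on the chain is faithful.

The reflection `h` is an involution that normalises the order-preserving submonoid, so every element
of the larger monoid is `s` or `s h` with `s` in the smaller one. If `s h = s'` then `s` is constant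
on its domain and therefore factors through `a_1^{n-1}`; there the relation `N₂` removes `h`. -/

/-! ### Monoids given by generators and relations -/

section Presentations

variable {A M : Type} [Monoid M]

/-- The monoid presented by the generators `A` and the relations `R`. -/
abbrev Presented (R : Relations A) : Type := PresentedMonoid fun u v => (u, v) ∈ R

/-- The elements `φ x` of `M` satisfy the relations `R`. -/
def Satisfies (φ : A → M) (R : Relations A) : Prop :=
  ∀ u v, (u, v) ∈ R → FreeMonoid.lift φ u = FreeMonoid.lift φ v

namespace Satisfies

variable {φ : A → M} {R : Relations A}

/-- The homomorphism from `⟨A | R⟩` to `M` that extends `φ`. -/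
def eval (h : Satisfies φ R) : Presented R →* M := PresentedMonoid.lift φ h

@[simp] theorem eval_of (h : Satisfies φ R) (x : A) : h.eval (PresentedMonoid.of _ x) = φ x :=
  PresentedMonoid.lift_of ..

theorem mrange_eval (h : Satisfies φ R) :
    MonoidHom.mrange h.eval = Submonoid.closure (Set.range φ) := by
  rw [MonoidHom.mrange_eq_map, ← PresentedMonoid.closure_range_of, MonoidHom.map_mclosure,
    ← Set.range_comp]
  exact congrArg _ (congrArg _ (funext h.eval_of))

end Satisfies

theorem definedBy_iff {S : Submonoid M} {φ : A → M} {R : Relations A} :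
    DefinedBy S φ R ↔
      ∃ h : Satisfies φ R, Function.Injective h.eval ∧ MonoidHom.mrange h.eval = S := by
  constructor
  · rintro ⟨f, hf⟩
    have lift_eq (u) : FreeMonoid.lift φ u = f (PresentedMonoid.mk _ u) :=
      DFunLike.congr_fun (FreeMonoid.hom_eq (f := FreeMonoid.lift φ)
        (g := S.subtype.comp (f.toMonoidHom.comp (PresentedMonoid.mk _)))
        fun x => (FreeMonoid.lift_eval_of ..).trans (hf x).symm) u
    have h : Satisfies φ R := fun u v huv => by
      rw [lift_eq, lift_eq, PresentedMonoid.mk_eq_mk_of_rel huv]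
    have eval_eq : h.eval = S.subtype.comp f.toMonoidHom :=
      PresentedMonoid.ext _ fun x => (h.eval_of x).trans (hf x).symm
    refine ⟨h, ?_, ?_⟩
    · rw [eval_eq]
      exact Subtype.val_injective.comp f.injective
    · have mrange_f : MonoidHom.mrange f.toMonoidHom = ⊤ := MonoidHom.mrange_eq_top.2 f.surjective
      rw [eval_eq, MonoidHom.mrange_comp, mrange_f, ← MonoidHom.mrange_eq_map,
        Submonoid.mrange_subtype]
  · rintro ⟨h, hinj, rfl⟩
    exact ⟨MulEquiv.ofBijective h.eval.mrangeRestrict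
      ⟨fun s t hst => hinj (congrArg Subtype.val hst), h.eval.mrangeRestrict_surjective⟩, h.eval_of⟩

end Presentations

/-! ### Adjoining an involution -/

section Involution

variable {N P M : Type*} [Monoid N] [Monoid P] [Monoid M] {θ : N →* P} {H : P}

theorem mul_eq_mul_of_mul_self_eq_one (hH : H * H = 1) {s t : P} (h : H * s = t * H) :
    H * t = s * H := by
  calc H * t = H * (t * H) * H := by rw [mul_assoc, mul_assoc, hH, mul_one]
    _ = s * H := by rw [← h, ← mul_assoc, hH, one_mul]

theorem exists_mul_map_eq_of_closure {G : Set N} (hG : Submonoid.closure G = ⊤)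
    (h : ∀ g ∈ G, ∃ s', H * θ g = θ s' * H) (s : N) : ∃ s', H * θ s = θ s' * H := by
  have hs : s ∈ Submonoid.closure G := hG ▸ Submonoid.mem_top s
  induction hs using Submonoid.closure_induction with
  | mem g hg => exact h g hg
  | one => exact ⟨1, by simp only [map_one, mul_one, one_mul]⟩
  | mul s t _ _ hs ht =>
    obtain ⟨s', hs⟩ := hs
    obtain ⟨t', ht⟩ := ht
    exact ⟨s' * t', by rw [map_mul, map_mul, ← mul_assoc, hs, mul_assoc, ht, mul_assoc]⟩

theorem exists_eq_map_or_eq_map_mul (hH : H * H = 1) (hconj : ∀ s, ∃ s', H * θ s = θ s' * H)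
    (hgen : Submonoid.closure (insert H (Set.range θ)) = ⊤) (t : P) :
    ∃ s, t = θ s ∨ t = θ s * H := by
  have ht : t ∈ Submonoid.closure (insert H (Set.range θ)) := hgen ▸ Submonoid.mem_top t
  induction ht using Submonoid.closure_induction_left with
  | one => exact ⟨1, Or.inl (map_one θ).symm⟩
  | mul_left g hg t _ ih =>
    obtain ⟨s, ht⟩ := ih
    rcases hg with rfl | ⟨r, rfl⟩
    · obtain ⟨s', hs⟩ := hconj s
      refine ⟨s', ?_⟩
      rcases ht with rfl | rfl
      · exact Or.inr hs
      · exact Or.inl (by rw [← mul_assoc, hs, mul_assoc, hH, mul_one])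
    · refine ⟨r * s, ?_⟩
      rcases ht with rfl | rfl
      · exact Or.inl (map_mul ..).symm
      · exact Or.inr (by rw [map_mul, mul_assoc])

theorem exists_map_mul_eq_map (hH : H * H = 1) (hconj : ∀ s, ∃ s', H * θ s = θ s' * H)
    {z z' : N} (hz : θ z * H = θ z') (s₁ s₂ : N) : ∃ s, θ (s₁ * z * s₂) * H = θ s := by
  obtain ⟨s₃, hs⟩ := hconj s₂
  refine ⟨s₁ * z' * s₃, ?_⟩
  calc θ (s₁ * z * s₂) * H = θ s₁ * θ z * (θ s₂ * H) := by simp only [map_mul, mul_assoc]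
    _ = θ s₁ * (θ z * H) * θ s₃ := by
      rw [← mul_eq_mul_of_mul_self_eq_one hH hs]
      simp only [mul_assoc]
    _ = θ (s₁ * z' * s₃) := by rw [hz, map_mul, map_mul]

theorem injective_of_involution {π : P →* M} (hH : H * H = 1)
    (hconj : ∀ s, ∃ s', H * θ s = θ s' * H) (hdec : ∀ t, ∃ s, t = θ s ∨ t = θ s * H)
    {z z' : N} (hz : θ z * H = θ z') (hinj : Function.Injective (π.comp θ))
    (hfac : ∀ s s', π (θ s * H) = π (θ s') → ∃ s₁ s₂, s = s₁ * z * s₂) :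
    Function.Injective π := by
  have mixed {s s' : N} (h : π (θ s * H) = π (θ s')) : θ s * H = θ s' := by
    obtain ⟨s₁, s₂, rfl⟩ := hfac s s' h
    obtain ⟨s'', hs⟩ := exists_map_mul_eq_map hH hconj hz s₁ s₂
    rw [hs] at h ⊢
    rw [hinj h]
  intro t t' htt'
  obtain ⟨s, rfl | rfl⟩ := hdec t <;> obtain ⟨s', rfl | rfl⟩ := hdec t'
  · rw [hinj htt']
  · exact (mixed htt'.symm).symm
  · exact mixed htt'
  · have h : π (θ s * H * H) = π (θ s' * H * H) := by rw [map_mul, htt', ← map_mul]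
    rw [mul_assoc, mul_assoc, hH, mul_one, mul_one] at h
    rw [hinj h]

end Involution

/-! ### Partial transformations as functions on natural numbers -/

namespace PT

variable {n : ℕ} {α : PT n}

/-- The value of a partial transformation at a natural number, `0` where it is undefined. -/
def val (α : PT n) (x : ℕ) : ℕ :=
  if hx : 1 ≤ x ∧ x ≤ n then (α ⟨x, hx⟩).elim 0 Subtype.val else 0

theorem val_of_eq_some {x y : Chain n} (h : α x = some y) : α.val x = y := by
  simp [val, x.2, h]

theorem val_of_eq_none {x : Chain n} (h : α x = none) : α.val x = 0 := by
  simp [val, h]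

theorem val_of_not_mem {x : ℕ} (hx : ¬(1 ≤ x ∧ x ≤ n)) : α.val x = 0 := dif_neg hx

theorem eq_some_iff {x y : Chain n} : α x = some y ↔ α.val x = y := by
  refine ⟨val_of_eq_some, fun h => ?_⟩
  cases hα : α x with
  | none => exact absurd (h.symm.trans (val_of_eq_none hα)) (by have := y.2; omega)
  | some z => rw [Subtype.ext ((val_of_eq_some hα).symm.trans h)]

theorem mem_of_val_ne_zero {x : ℕ} (hx : α.val x ≠ 0) : 1 ≤ x ∧ x ≤ n := by
  by_contra h
  exact hx (val_of_not_mem h)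

theorem exists_eq_some_of_val_ne_zero {x : ℕ} (hx : α.val x ≠ 0) :
    ∃ u v : Chain n, α u = some v ∧ u.1 = x ∧ v.1 = α.val x := by
  have hxn := mem_of_val_ne_zero hx
  cases hα : α ⟨x, hxn⟩ with
  | none => exact absurd (val_of_eq_none hα) hx
  | some v => exact ⟨⟨x, hxn⟩, v, hα, rfl, (val_of_eq_some hα).symm⟩

theorem val_ne_zero_of_eq_some {x y : Chain n} (h : α x = some y) : α.val x ≠ 0 := by
  rw [val_of_eq_some h]
  have := y.2
  omega

theorem val_le (α : PT n) (x : ℕ) : α.val x ≤ n := by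
  by_cases hx : α.val x = 0
  · omega
  · obtain ⟨u, v, -, -, hv⟩ := exists_eq_some_of_val_ne_zero hx
    exact hv ▸ v.2.2

theorem ext_val {β : PT n} (h : ∀ x, 1 ≤ x → x ≤ n → α.val x = β.val x) : α = β := by
  funext x
  refine Option.ext fun y => ?_
  rw [eq_some_iff, eq_some_iff, h x x.2.1 x.2.2]

theorem val_mul (α β : PT n) (x : ℕ) : (α * β).val x = β.val (α.val x) := by
  by_cases hx : 1 ≤ x ∧ x ≤ n
  · cases hα : α ⟨x, hx⟩ with
    | none => simp [val, hx, mul_apply, hα]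
    | some y => simp [val, hx, mul_apply, hα, y.2]
  · rw [val_of_not_mem hx, val_of_not_mem hx, val_of_not_mem (by omega)]

theorem val_zero (α : PT n) : α.val 0 = 0 := val_of_not_mem (by omega)

theorem val_one {x : ℕ} (hx : x ≤ n) : (1 : PT n).val x = x := by
  rcases x.eq_zero_or_pos with rfl | h
  · exact val_zero 1
  · exact val_of_eq_some (one_apply ⟨x, h, hx⟩)

theorem orderPreserving_iff_val : α.OrderPreserving ↔
    ∀ x y, α.val x ≠ 0 → α.val y ≠ 0 → x ≤ y → α.val x ≤ α.val y := by
  constructor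
  · intro h x y hx hy hxy
    obtain ⟨u, u', hu, rfl, hu'⟩ := exists_eq_some_of_val_ne_zero hx
    obtain ⟨v, v', hv, rfl, hv'⟩ := exists_eq_some_of_val_ne_zero hy
    exact hu' ▸ hv' ▸ h.le hu hv hxy
  · intro h x y x' y' hx hy hxy
    have := h x y (val_ne_zero_of_eq_some hx) (val_ne_zero_of_eq_some hy) hxy.le
    rwa [val_of_eq_some hx, val_of_eq_some hy] at this

theorem orderReversing_iff_val : α.OrderReversing ↔
    ∀ x y, α.val x ≠ 0 → α.val y ≠ 0 → x ≤ y → α.val y ≤ α.val x := by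
  constructor
  · intro h x y hx hy hxy
    obtain ⟨u, u', hu, rfl, hu'⟩ := exists_eq_some_of_val_ne_zero hx
    obtain ⟨v, v', hv, rfl, hv'⟩ := exists_eq_some_of_val_ne_zero hy
    exact hu' ▸ hv' ▸ h.le hu hv hxy
  · intro h x y x' y' hx hy hxy
    have := h x y (val_ne_zero_of_eq_some hx) (val_ne_zero_of_eq_some hy) hxy.le
    rwa [val_of_eq_some hx, val_of_eq_some hy] at this

theorem hasIntervals_iff_val : α.HasIntervals ↔
    (∀ x y z, α.val x ≠ 0 → α.val z ≠ 0 → x ≤ y → y ≤ z → α.val y ≠ 0) ∧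
      ∀ x v z, α.val x ≠ 0 → α.val x ≤ v → v ≤ α.val z → ∃ y, α.val y = v := by
  constructor
  · rintro ⟨hdom, him⟩
    refine ⟨fun x y z hx hz hxy hyz => ?_, fun x v z hx hxv hvz => ?_⟩
    · obtain ⟨u, u', hu, rfl, -⟩ := exists_eq_some_of_val_ne_zero hx
      obtain ⟨w, w', hw, rfl, -⟩ := exists_eq_some_of_val_ne_zero hz
      obtain ⟨v, hv⟩ := hdom.out ⟨u', hu⟩ ⟨w', hw⟩
        (⟨hxy, hyz⟩ : (⟨y, u.2.1.trans hxy, hyz.trans w.2.2⟩ : Chain n) ∈ Set.Icc u w)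
      exact val_ne_zero_of_eq_some hv
    · obtain ⟨u, u', hu, rfl, hu'⟩ := exists_eq_some_of_val_ne_zero hx
      obtain ⟨w, w', hw, rfl, hw'⟩ :=
        exists_eq_some_of_val_ne_zero (α := α) (x := z) (by omega)
      rw [← hu'] at hxv
      rw [← hw'] at hvz
      obtain ⟨y, hy⟩ := him.out ⟨u, hu⟩ ⟨w, hw⟩
        (⟨hxv, hvz⟩ : (⟨v, u'.2.1.trans hxv, hvz.trans w'.2.2⟩ : Chain n) ∈ Set.Icc u' w')
      exact ⟨y, val_of_eq_some hy⟩
  · rintro ⟨hdom, him⟩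
    refine ⟨⟨?_⟩, ⟨?_⟩⟩
    · rintro x ⟨x', hx⟩ z ⟨z', hz⟩ y ⟨hxy, hyz⟩
      obtain ⟨u, v, hu, huy, -⟩ := exists_eq_some_of_val_ne_zero
        (hdom x y z (val_ne_zero_of_eq_some hx) (val_ne_zero_of_eq_some hz) hxy hyz)
      exact ⟨v, Subtype.ext huy ▸ hu⟩
    · rintro x' ⟨x, hx⟩ z' ⟨z, hz⟩ y' ⟨hxy, hyz⟩
      obtain ⟨y, hy⟩ := him x y' z (val_ne_zero_of_eq_some hx)
        (by rwa [val_of_eq_some hx]) (by rwa [val_of_eq_some hz])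
      obtain ⟨u, v, hu, rfl, hv⟩ := exists_eq_some_of_val_ne_zero (α := α) (x := y)
        (by have := y'.2; omega)
      exact ⟨u, Subtype.ext (hv.trans hy) ▸ hu⟩

end PT

section Letters

variable {n : ℕ}

theorem PIOLetter.val_a (i : ℕ) (hi : 1 ≤ i ∧ i < n) (x : ℕ) :
    (a i hi).toPT.val x = if x ≤ i then x else if x ≤ n then x - 1 else 0 := by
  unfold PT.val toPT
  grind

theorem PIOLetter.val_b (i : ℕ) (hi : 1 ≤ i ∧ i < n) (x : ℕ) :
    (b i hi).toPT.val x =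
      if x = 0 then 0 else if x ≤ i then x + 1 else if x ≤ n then x else 0 := by
  unfold PT.val toPT
  grind

theorem PIOLetter.val_e (i : ℕ) (hi : 1 ≤ i ∧ i < n) (x : ℕ) :
    (e i hi).toPT.val x = if x ≤ i then x else 0 := by
  unfold PT.val toPT
  grind

theorem PIOLetter.val_f (j : ℕ) (hj : 2 ≤ j ∧ j ≤ n) (x : ℕ) :
    (f j hj).toPT.val x = if j ≤ x ∧ x ≤ n then x else 0 := by
  unfold PT.val toPT
  grind

theorem PIMLetter.val_h (x : ℕ) :
    (h : PIMLetter n).toPT.val x = if 1 ≤ x ∧ x ≤ n then n + 1 - x else 0 := by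
  unfold PT.val toPT
  grind

theorem PIMLetter.h_mul_h : (h : PIMLetter n).toPT * (h : PIMLetter n).toPT = 1 :=
  PT.ext_val fun x h₁ h₂ => by
    rw [PT.val_mul, val_h, val_h, PT.val_one h₂]
    grind

end Letters

/-! ### Membership in the two monoids -/

section Membership

variable {n : ℕ} {α : PT n}

theorem PIOLetter.orderPreserving (x : PIOLetter n) : x.toPT.OrderPreserving := by
  rw [PT.orderPreserving_iff_val]
  cases x <;> grind [val_a, val_b, val_e, val_f]

theorem PIOLetter.hasIntervals (x : PIOLetter n) : x.toPT.HasIntervals := by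
  rw [PT.hasIntervals_iff_val]
  refine ⟨by cases x <;> grind [val_a, val_b, val_e, val_f], fun x₁ v x₂ hx₁ h₁ h₂ => ?_⟩
  cases x with
  | a i hi =>
    refine ⟨if v ≤ i then v else v + 1, ?_⟩
    grind [val_a]
  | b i hi =>
    refine ⟨if v ≤ i + 1 then v - 1 else v, ?_⟩
    grind [val_b]
  | e i hi => exact ⟨v, by grind [val_e]⟩
  | f j hj => exact ⟨v, by grind [val_f]⟩

theorem PIOLetter.toPT_mem (x : PIOLetter n) : x.toPT ∈ PIOn n :=
  ⟨x.orderPreserving, x.hasIntervals⟩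

theorem PIMLetter.orderReversing_h : (h : PIMLetter n).toPT.OrderReversing := by
  rw [PT.orderReversing_iff_val]
  grind [val_h]

theorem PIMLetter.hasIntervals_h : (h : PIMLetter n).toPT.HasIntervals := by
  rw [PT.hasIntervals_iff_val]
  refine ⟨by grind [val_h], fun x v z hx h₁ h₂ => ⟨n + 1 - v, ?_⟩⟩
  grind [val_h]

theorem PIMLetter.toPT_mem (x : PIMLetter n) : x.toPT ∈ PIMn n := by
  cases x with
  | of x => exact ⟨Or.inl x.orderPreserving, x.hasIntervals⟩
  | h => exact ⟨Or.inr orderReversing_h, hasIntervals_h⟩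

theorem PT.OrderReversing.mul {β : PT n} (hα : α.OrderReversing) (hβ : β.OrderReversing) :
    (α * β).OrderPreserving := by
  intro x y x' y' hx hy hxy
  obtain ⟨u, hu, hux⟩ := mul_eq_some.1 hx
  obtain ⟨v, hv, hvy⟩ := mul_eq_some.1 hy
  exact hβ.le hvy hux (hα.le hu hv hxy.le)

theorem mem_PIMn_iff_mem_PIOn_or :
    α ∈ PIMn n ↔ α ∈ PIOn n ∨ α * (PIMLetter.h : PIMLetter n).toPT ∈ PIOn n := by
  have PIOn_le : PIOn n ≤ PIMn n := fun _ h => ⟨Or.inl h.1, h.2⟩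
  constructor
  · rintro ⟨hα | hα, hi⟩
    · exact Or.inl ⟨hα, hi⟩
    · exact Or.inr ⟨hα.mul PIMLetter.orderReversing_h,
        hi.mul (Or.inr hα) (Or.inr PIMLetter.orderReversing_h) PIMLetter.hasIntervals_h⟩
  · rintro (hα | hα)
    · exact PIOn_le hα
    · have := mul_mem (PIOn_le hα) (PIMLetter.h : PIMLetter n).toPT_mem
      rwa [mul_assoc, PIMLetter.h_mul_h, mul_one] at this

theorem exists_val_ne_zero_iff_of_mem_PIOn (hα : α ∈ PIOn n) :
    ∃ p q, 1 ≤ p ∧ q ≤ n ∧ ∀ x, α.val x ≠ 0 ↔ p ≤ x ∧ x ≤ q := by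
  classical
  have hconn := (PT.hasIntervals_iff_val.1 hα.2).1
  by_cases hne : ∃ x, α.val x ≠ 0
  · have hp := Nat.find_spec hne
    obtain ⟨m, hm⟩ := hne
    have hmn := PT.mem_of_val_ne_zero hm
    have hq := Nat.findGreatest_spec (P := fun x => α.val x ≠ 0) hmn.2 hm
    exact ⟨_, _, (PT.mem_of_val_ne_zero hp).1, (PT.mem_of_val_ne_zero hq).2, fun x =>
      ⟨fun hx => ⟨Nat.find_min' _ hx, Nat.le_findGreatest (PT.mem_of_val_ne_zero hx).2 hx⟩,
        fun hx => hconn _ x _ hp hq hx.1 hx.2⟩⟩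
  · push Not at hne
    exact ⟨1, 0, le_rfl, n.zero_le, fun x => by simp only [hne]; omega⟩

theorem val_add_one_of_mem_PIOn (hα : α ∈ PIOn n) {x : ℕ} (hx : α.val x ≠ 0)
    (hx' : α.val (x + 1) ≠ 0) : α.val (x + 1) = α.val x ∨ α.val (x + 1) = α.val x + 1 := by
  have hmono := PT.orderPreserving_iff_val.1 hα.1
  have hle := hmono x (x + 1) hx hx' (by omega)
  by_contra hgap
  obtain ⟨y, hy⟩ := (PT.hasIntervals_iff_val.1 hα.2).2 x (α.val x + 1) (x + 1) hx (by omega)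
    (by omega)
  rcases Nat.lt_or_ge x y with hxy | hxy
  · have := hmono (x + 1) y hx' (by omega) hxy
    omega
  · have := hmono y x (by omega) hx hxy
    omega

theorem exists_val_eq_zero_or_eq_of_mul_h_mem_PIOn (hn : 1 ≤ n) (hα : α ∈ PIOn n)
    (hαh : α * (PIMLetter.h : PIMLetter n).toPT ∈ PIOn n) :
    ∃ d, 1 ≤ d ∧ d ≤ n ∧ ∀ x, α.val x = 0 ∨ α.val x = d := by
  by_cases hne : ∃ m, α.val m ≠ 0
  · obtain ⟨m, hm⟩ := hne
    have hmono := PT.orderPreserving_iff_val.1 hα.1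
    have hanti := PT.orderPreserving_iff_val.1 hαh.1
    simp only [PT.val_mul, PIMLetter.val_h] at hanti
    refine ⟨α.val m, by omega, α.val_le m, fun x => ?_⟩
    have := α.val_le m
    have := α.val_le x
    rcases le_total x m with h | h
    · grind
    · grind
  · push Not at hne
    exact ⟨1, le_rfl, hn, fun x => Or.inl (hne x)⟩

end Membership

/-! ### The monoid presented by `PIORelations n` -/

theorem satisfies_PIORelations (n : ℕ) : Satisfies PIOLetter.toPT (PIORelations n) := by
  refine fun u v (h : PIORel n u v) => PT.ext_val fun x _ hx => ?_
  cases h <;>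
  simp only [map_mul, wa, wb, we, wf, FreeMonoid.lift_eval_of, PT.val_mul, PIOLetter.val_a,
    PIOLetter.val_b, PIOLetter.val_e, PIOLetter.val_f] <;>
  split_ifs <;> omega

/-- The monoid presented by `PIORelations n`. -/
abbrev PIOPres (n : ℕ) : Type := Presented (PIORelations n)

namespace PIOPres

variable {n : ℕ}

/-- The class of a word. -/
abbrev mk (n : ℕ) : FreeMonoid (PIOLetter n) →* PIOPres n := PresentedMonoid.mk _

/-- The class of `a_i`, extended by `1` outside `1 ≤ i ≤ n - 1`. -/
def genA (n i : ℕ) : PIOPres n := if h : 1 ≤ i ∧ i < n then mk n (wa i h) else 1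

/-- The class of `b_i`, extended by `1` outside `1 ≤ i ≤ n - 1`. -/
def genB (n i : ℕ) : PIOPres n := if h : 1 ≤ i ∧ i < n then mk n (wb i h) else 1

/-- The class of `e_i`, extended by `1` outside `1 ≤ i ≤ n - 1`; for `i ≥ n` this agrees with the
partial identity on `{1, …, i} ∩ {1, …, n}`. -/
def genE (n i : ℕ) : PIOPres n := if h : 1 ≤ i ∧ i < n then mk n (we i h) else 1

/-- The class of `f_j`, extended by `1` outside `2 ≤ j ≤ n`; for `j ≤ 1` this agrees with the
partial identity on `{j, …, n} ∩ {1, …, n}`. -/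
def genF (n j : ℕ) : PIOPres n := if h : 2 ≤ j ∧ j ≤ n then mk n (wf j h) else 1

/-- The class of `f_n e_1`, which denotes the empty transformation. -/
def zero (n : ℕ) : PIOPres n := genF n n * genE n 1

theorem mk_wa (i : ℕ) (hi : 1 ≤ i ∧ i < n) : mk n (wa i hi) = genA n i := by
  rw [genA, dif_pos hi]

theorem mk_wb (i : ℕ) (hi : 1 ≤ i ∧ i < n) : mk n (wb i hi) = genB n i := by
  rw [genB, dif_pos hi]

theorem mk_we (i : ℕ) (hi : 1 ≤ i ∧ i < n) : mk n (we i hi) = genE n i := by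
  rw [genE, dif_pos hi]

theorem mk_wf (j : ℕ) (hj : 2 ≤ j ∧ j ≤ n) : mk n (wf j hj) = genF n j := by
  rw [genF, dif_pos hj]

theorem genE_of_le {i : ℕ} (hi : n ≤ i) : genE n i = 1 := dif_neg (by omega)

theorem genF_of_le_one {j : ℕ} (hj : j ≤ 1) : genF n j = 1 := dif_neg (by omega)

theorem mk_eq_mk {u v : FreeMonoid (PIOLetter n)} (h : PIORel n u v) : mk n u = mk n v :=
  PresentedMonoid.mk_eq_mk_of_rel h

theorem genA_mul_genA {i j : ℕ} (hi : 1 ≤ i) (hij : i ≤ j) (hj : j + 1 < n) :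
    genA n i * genA n j = genA n (j + 1) * genA n i := by
  simpa only [map_mul, mk_wa] using mk_eq_mk (.aa i j hi hij hj)

theorem genA_mul_genA_last {i : ℕ} (hi : 1 ≤ i) (hn : i < n) :
    genA n i * genA n (n - 1) = genA n i := by
  simpa only [map_mul, mk_wa] using mk_eq_mk (.aa_last i hi hn)

theorem genA_mul_genB_last {i : ℕ} (hi : 1 ≤ i) (hn : i < n) :
    genA n i * genB n (n - 1) = genB n i := by
  simpa only [map_mul, mk_wa, mk_wb] using mk_eq_mk (.ab_last i hi hn)

theorem genB_mul_genA_one {i : ℕ} (hi : 1 ≤ i) (hn : i < n) :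
    genB n i * genA n 1 = genA n i := by
  simpa only [map_mul, mk_wa, mk_wb] using mk_eq_mk (.ba_first i hi hn)

theorem genB_last_mul_genA_succ {k : ℕ} (hk : 1 ≤ k) (hn : k + 1 < n) :
    genB n (n - 1) * genA n (k + 1) = genA n (n - 1) * genA n k * genB n (n - 1) := by
  obtain ⟨m, rfl⟩ : ∃ m, n = m + 2 := ⟨n - 2, by omega⟩
  have h : genA (m + 2) k * genB (m + 2) m = genB (m + 2) (m + 1) * genA (m + 2) (k + 1) := by
    simpa only [map_mul, mk_wa, mk_wb] using
      mk_eq_mk (PIORel.ab (n := m + 2) k m hk (by omega) (by omega))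
  rw [show m + 2 - 1 = m + 1 from rfl, ← h, ← genA_mul_genA hk (by omega) (by omega), mul_assoc]
  exact congrArg _ (genA_mul_genB_last (by omega) (by omega)).symm

theorem genE_mul_genE {i j : ℕ} (hi : 1 ≤ i) (hj : 1 ≤ j) :
    genE n i * genE n j = genE n (min i j) := by
  have absorb_right {i j : ℕ} (hi : 1 ≤ i) (hij : i ≤ j) : genE n i * genE n j = genE n i := by
    by_cases hj : j < n
    · simpa only [map_mul, mk_we] using mk_eq_mk (.ee i j hi hij hj)
    · rw [genE_of_le (i := j) (by omega), mul_one]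
  rcases le_total i j with h | h
  · rw [min_eq_left h, absorb_right hi h]
  · rw [min_eq_right h]
    induction i, h using Nat.le_induction with
    | base => exact absorb_right hj le_rfl
    | succ i hij ih =>
      by_cases hin : i + 1 < n
      · have h : genE n (i + 1) * genE n i = genE n i := by
          simpa only [map_mul, mk_we] using mk_eq_mk (.ee_succ i (by omega) hin)
        rw [← ih (by omega), ← mul_assoc, h]
      · rw [genE_of_le (by omega), one_mul]

theorem genF_mul_genF {i j : ℕ} (hi : i ≤ n) (hj : j ≤ n) :
    genF n i * genF n j = genF n (max i j) := by
  have absorb_right {i j : ℕ} (hij : i ≤ j) (hj : j ≤ n) : genF n j * genF n i = genF n j := by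
    by_cases hi : 2 ≤ i
    · simpa only [map_mul, mk_wf] using mk_eq_mk (.ff i j hi hij hj)
    · rw [genF_of_le_one (j := i) (by omega), mul_one]
  rcases le_total j i with h | h
  · rw [max_eq_left h, absorb_right h hi]
  · rw [max_eq_right h]
    induction j, h using Nat.le_induction with
    | base => exact absorb_right le_rfl hi
    | succ j hij ih =>
      by_cases hj2 : 2 ≤ j
      · have h : genF n j * genF n (j + 1) = genF n (j + 1) := by
          simpa only [map_mul, mk_wf] using mk_eq_mk (.ff_succ j hj2 (by omega))
        rw [← h, ← mul_assoc, ih (by omega)]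
      · rw [genF_of_le_one (by omega), one_mul]

theorem genF_mul_genE {i j : ℕ} (hij : j ≤ i + 1) :
    genF n j * genE n i = genE n i * genF n j := by
  by_cases hi : i < n
  · by_cases hj : 2 ≤ j
    · simpa only [map_mul, mk_we, mk_wf] using mk_eq_mk (.fe i j hj hij hi)
    · rw [genF_of_le_one (by omega), one_mul, mul_one]
  · rw [genE_of_le (by omega), one_mul, mul_one]

theorem genE_mul_genA {i : ℕ} (hi : 1 ≤ i) (hn : i < n) : genE n i * genA n i = genE n i := by
  simpa only [map_mul, mk_we, mk_wa] using mk_eq_mk (.ea i hi hn)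

theorem genF_succ_mul_genB {i : ℕ} (hi : 1 ≤ i) (hn : i < n) :
    genF n (i + 1) * genB n i = genF n (i + 1) := by
  simpa only [map_mul, mk_wf, mk_wb] using mk_eq_mk (.fb i hi hn)

theorem genA_mul_genF_last {i : ℕ} (hi : 1 ≤ i) (hn : i < n) :
    genA n i * genF n n = zero n := by
  simpa only [map_mul, mk_we, mk_wf, mk_wa, zero] using mk_eq_mk (.af_zero i hi hn)

theorem genB_mul_genE_one {i : ℕ} (hi : 1 ≤ i) (hn : i < n) :
    genB n i * genE n 1 = zero n := by
  simpa only [map_mul, mk_we, mk_wf, mk_wb, zero] using mk_eq_mk (.be_zero i hi hn)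

theorem genE_mul_genF_succ {i : ℕ} (hi : 1 ≤ i) (hn : i < n) :
    genE n i * genF n (i + 1) = zero n := by
  rw [← genA_mul_genF_last hi hn]
  simpa only [map_mul, mk_we, mk_wf, mk_wa] using mk_eq_mk (.ef_zero i hi hn)

theorem genF_succ_mul_genE {i : ℕ} (hi : 1 ≤ i) (hn : i < n) :
    genF n (i + 1) * genE n i = zero n := by
  rw [genF_mul_genE le_rfl, genE_mul_genF_succ hi hn]

theorem genE_mul_zero {i : ℕ} (hi : 1 ≤ i) : genE n i * zero n = zero n := by
  by_cases hn : i < n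
  · rw [← genE_mul_genF_succ hi hn, ← mul_assoc, genE_mul_genE hi hi, min_self]
  · rw [genE_of_le (by omega), one_mul]

theorem genF_mul_zero {j : ℕ} (hn : j ≤ n) : genF n j * zero n = zero n := by
  rw [zero, ← mul_assoc, genF_mul_genF hn le_rfl, max_eq_right hn]

theorem zero_mul_genF (hn : 2 ≤ n) {j : ℕ} (hjn : j ≤ n) : zero n * genF n j = zero n := by
  rw [← genA_mul_genF_last (i := 1) le_rfl hn, mul_assoc, genF_mul_genF le_rfl hjn,
    max_eq_left hjn]

theorem genA_mul_zero {i : ℕ} (hi : 1 ≤ i) (hn : i < n) : genA n i * zero n = zero n := by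
  rw [zero, ← mul_assoc, genA_mul_genF_last hi hn, zero, mul_assoc, genE_mul_genE le_rfl le_rfl,
    min_self]

theorem genB_mul_zero {i : ℕ} (hi : 1 ≤ i) (hn : i < n) : genB n i * zero n = zero n := by
  have h : genB n (n - 1) * zero n = zero n := by
    simpa only [map_mul, mk_we, mk_wf, mk_wb, zero] using
      mk_eq_mk (.b_zero (n := n) (by omega))
  rw [← genA_mul_genB_last hi hn, mul_assoc, h, genA_mul_zero hi hn]

theorem zero_mul_genA {i : ℕ} (hi : 1 ≤ i) (hn : i < n) : zero n * genA n i = zero n := by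
  rw [← genF_succ_mul_genE hi hn, mul_assoc, genE_mul_genA hi hn]

theorem zero_mul_genB {i : ℕ} (hi : 1 ≤ i) (hn : i < n) : zero n * genB n i = zero n := by
  rw [← genE_mul_genF_succ hi hn, mul_assoc, genF_succ_mul_genB hi hn]

theorem genE_mul_genF_of_lt {i j : ℕ} (hi : 1 ≤ i) (hij : i < j) (hj : j ≤ n) :
    genE n i * genF n j = zero n := by
  rw [← max_eq_right (show i + 1 ≤ j from hij), ← genF_mul_genF (by omega) hj, ← mul_assoc,
    genE_mul_genF_succ hi (by omega), zero_mul_genF (by omega) hj]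

theorem genF_mul_genE_of_lt {i j : ℕ} (hi : 1 ≤ i) (hij : i < j) (hj : j ≤ n) :
    genF n j * genE n i = zero n := by
  rw [← max_eq_left (show i + 1 ≤ j from hij), ← genF_mul_genF hj (by omega), mul_assoc,
    genF_succ_mul_genE hi (by omega), genF_mul_zero hj]

theorem genA_mul_genE_of_le {i j : ℕ} (hi : 1 ≤ i) (hij : i ≤ j) :
    genA n i * genE n j = genE n (j + 1) * genA n i := by
  rcases lt_trichotomy (j + 1) n with hj | rfl | hj
  · simpa only [map_mul, mk_we, mk_wa] using mk_eq_mk (.ae i j hi hij hj)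
  · rw [genE_of_le le_rfl, one_mul]
    simpa only [map_mul, mk_we, mk_wa, Nat.add_sub_cancel] using
      mk_eq_mk (.ae_last (n := j + 1) i hi (by omega))
  · rw [genE_of_le (by omega), genE_of_le (by omega), mul_one, one_mul]

theorem genA_mul_genE_of_lt {i j : ℕ} (hj : 1 ≤ j) (hij : j < i) (hi : i < n) :
    genA n i * genE n j = genE n j := by
  obtain ⟨k, rfl⟩ : ∃ k, i = k + 1 := ⟨i - 1, by omega⟩
  have h : genA n (k + 1) * genE n k = genE n k := by
    simpa only [map_mul, mk_we, mk_wa, Nat.add_sub_cancel] using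
      mk_eq_mk (.ae_pred (k + 1) (by omega) hi)
  rw [← min_eq_right (show j ≤ k by omega), ← genE_mul_genE (by omega) hj, ← mul_assoc, h]

theorem genB_mul_genE_of_le {i j : ℕ} (hj : 2 ≤ j) (hij : j ≤ i) (hi : i < n) :
    genB n i * genE n j = genE n (j - 1) * genB n i := by
  simpa only [map_mul, mk_we, mk_wb] using mk_eq_mk (.be i j hj hij hi)

theorem genB_mul_genE_of_lt {i j : ℕ} (hi : 1 ≤ i) (hij : i < j) :
    genB n i * genE n j = genE n j * genB n i := by
  by_cases hj : j < n
  · rw [← genA_mul_genB_last hi (by omega), mul_assoc,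
      genB_mul_genE_of_le (by omega) (by omega) (by omega), ← mul_assoc,
      genA_mul_genE_of_le hi (by omega), Nat.sub_add_cancel (by omega), mul_assoc]
  · rw [genE_of_le (by omega), mul_one, one_mul]

theorem genB_mul_genF_of_le {i j : ℕ} (hij : j ≤ i + 1) (hi : i < n) :
    genB n i * genF n j = genF n (j - 1) * genB n i := by
  obtain hj | rfl | hj : j ≤ 1 ∨ j = 2 ∨ 3 ≤ j := by omega
  · rw [genF_of_le_one hj, genF_of_le_one (by omega), mul_one, one_mul]
  · rw [genF_of_le_one (j := 2 - 1) le_rfl, one_mul]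
    simpa only [map_mul, mk_wf, mk_wb] using mk_eq_mk (.bf_first i (by omega) hi)
  · simpa only [map_mul, mk_wf, mk_wb] using mk_eq_mk (.bf i j hj hij hi)

theorem genB_mul_genF_of_lt {i j : ℕ} (hi : 1 ≤ i) (hij : i + 1 < j) (hj : j ≤ n) :
    genB n i * genF n j = genF n j := by
  have h : genB n i * genF n (i + 2) = genF n (i + 2) := by
    simpa only [map_mul, mk_wf, mk_wb] using mk_eq_mk (.bf_succ i hi (by omega))
  rw [← max_eq_right (show i + 2 ≤ j from hij), ← genF_mul_genF (by omega) hj, ← mul_assoc, h]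

theorem genA_mul_genF_of_lt {i j : ℕ} (hi : 1 ≤ i) (hij : i < j) (hj : j < n) :
    genA n i * genF n j = genF n (j + 1) * genA n i := by
  simpa only [map_mul, mk_wf, mk_wa] using mk_eq_mk (.af i j hi hij hj)

theorem genA_mul_genF_of_le {i j : ℕ} (hij : j ≤ i) (hi : i < n) :
    genA n i * genF n j = genF n j * genA n i := by
  by_cases hj : 2 ≤ j
  · rw [← genB_mul_genA_one (by omega) hi, mul_assoc,
      genA_mul_genF_of_lt le_rfl (by omega) (by omega), ← mul_assoc,
      genB_mul_genF_of_le (by omega) hi, Nat.add_sub_cancel, mul_assoc]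
  · rw [genF_of_le_one (by omega), mul_one, one_mul]

/-! ### The action on the chain -/

/-- The homomorphism to `PT n` that sends every generator to the transformation it denotes. -/
def eval (n : ℕ) : PIOPres n →* PT n := (satisfies_PIORelations n).eval

/-- The transformation denoted by an element, as a function on `ℕ` (`0` where undefined). -/
def act (t : PIOPres n) : ℕ → ℕ := (eval n t).val

theorem act_mul (s t : PIOPres n) : act (s * t) = act t ∘ act s := by
  funext x
  rw [act, map_mul, PT.val_mul]
  rfl

theorem act_one {x : ℕ} (hx : x ≤ n) : act (1 : PIOPres n) x = x := by
  rw [act, map_one, PT.val_one hx]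

theorem act_genA {i : ℕ} (hi : 1 ≤ i) (hn : i < n) (x : ℕ) :
    act (genA n i) x = if x ≤ i then x else if x ≤ n then x - 1 else 0 := by
  rw [← mk_wa i ⟨hi, hn⟩]
  exact PIOLetter.val_a i ⟨hi, hn⟩ x

theorem act_genB {i : ℕ} (hi : 1 ≤ i) (hn : i < n) (x : ℕ) :
    act (genB n i) x = if x = 0 then 0 else if x ≤ i then x + 1 else if x ≤ n then x else 0 := by
  rw [← mk_wb i ⟨hi, hn⟩]
  exact PIOLetter.val_b i ⟨hi, hn⟩ x

theorem act_genE {i : ℕ} (hi : 1 ≤ i) {x : ℕ} (hx : x ≤ n) :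
    act (genE n i) x = if x ≤ i then x else 0 := by
  by_cases hn : i < n
  · rw [← mk_we i ⟨hi, hn⟩]
    exact PIOLetter.val_e i ⟨hi, hn⟩ x
  · rw [genE_of_le (by omega), act_one hx, if_pos (by omega)]

theorem act_genF {j : ℕ} (hj : j ≤ n) {x : ℕ} (hx : x ≤ n) :
    act (genF n j) x = if j ≤ x then x else 0 := by
  by_cases hj2 : 2 ≤ j
  · rw [← mk_wf j ⟨hj2, hj⟩]
    refine (PIOLetter.val_f j ⟨hj2, hj⟩ x).trans ?_
    simp only [hx, and_true]
  · rw [genF_of_le_one (by omega), act_one hx]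
    split_ifs <;> omega

theorem act_genE_mul_genF_mul {p q : ℕ} (hq : 1 ≤ q) (hp : p ≤ n) (w : PIOPres n) {x : ℕ}
    (hx : x ≤ n) : act (genE n q * genF n p * w) x = if p ≤ x ∧ x ≤ q then act w x else 0 := by
  have hzero (t : PIOPres n) : act t 0 = 0 := PT.val_zero _
  rw [act_mul, act_mul, Function.comp_apply, Function.comp_apply, act_genE hq hx]
  by_cases hxq : x ≤ q
  · rw [if_pos hxq, act_genF hp hx]
    by_cases hpx : p ≤ x
    · rw [if_pos hpx, if_pos ⟨hpx, hxq⟩]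
    · rw [if_neg hpx, if_neg (by omega), hzero]
  · rw [if_neg hxq, if_neg (by omega), hzero, hzero]

theorem act_zero (hn : 2 ≤ n) {x : ℕ} (hx : x ≤ n) : act (zero n) x = 0 := by
  rw [← genE_mul_genF_of_lt (i := 1) le_rfl hn le_rfl, ← mul_one (_ * _),
    act_genE_mul_genF_mul le_rfl le_rfl 1 hx, act_one hx]
  split_ifs <;> omega

end PIOPres

/-! ### Full transformations and their normal form -/

section Powers

variable {n : ℕ}

theorem PIOLetter.val_a_pow (i : ℕ) (hi : 1 ≤ i ∧ i < n) (k : ℕ) {x : ℕ} (hx : x ≤ n) :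
    ((a i hi).toPT ^ k).val x = min x (max (x - k) i) := by
  induction k generalizing x with
  | zero => rw [pow_zero, PT.val_one hx]; omega
  | succ k ih =>
    rw [pow_succ', PT.val_mul, val_a, ih (by split_ifs <;> omega)]
    split_ifs <;> omega

theorem PIOLetter.val_b_pow (i : ℕ) (hi : 1 ≤ i ∧ i < n) (k : ℕ) {x : ℕ} (hx₁ : 1 ≤ x)
    (hx : x ≤ n) : ((b i hi).toPT ^ k).val x = max x (min (x + k) (i + 1)) := by
  induction k generalizing x with
  | zero => rw [pow_zero, PT.val_one hx]; omega
  | succ k ih =>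
    rw [pow_succ', PT.val_mul, val_b, ih (by split_ifs <;> omega) (by split_ifs <;> omega)]
    split_ifs <;> omega

end Powers

namespace PIOPres

variable {n : ℕ}

theorem act_genA_pow {i : ℕ} (hi : 1 ≤ i) (hn : i < n) (k : ℕ) {x : ℕ} (hx : x ≤ n) :
    act (genA n i ^ k) x = min x (max (x - k) i) := by
  rw [← mk_wa i ⟨hi, hn⟩, act, map_pow]
  exact PIOLetter.val_a_pow i ⟨hi, hn⟩ k hx

theorem act_genB_pow {i : ℕ} (hi : 1 ≤ i) (hn : i < n) (k : ℕ) {x : ℕ} (hx₁ : 1 ≤ x)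
    (hx : x ≤ n) : act (genB n i ^ k) x = max x (min (x + k) (i + 1)) := by
  rw [← mk_wb i ⟨hi, hn⟩, act, map_pow]
  exact PIOLetter.val_b_pow i ⟨hi, hn⟩ k hx₁ hx

theorem mrange_eval_le (n : ℕ) : MonoidHom.mrange (eval n) ≤ PIOn n := by
  rw [eval, Satisfies.mrange_eval, Submonoid.closure_le]
  exact Set.range_subset_iff.2 PIOLetter.toPT_mem

theorem eval_mem (t : PIOPres n) : eval n t ∈ PIOn n := mrange_eval_le n ⟨t, rfl⟩

/-- The submonoid of `PIOPres n` generated by the `a_i` and the `b_i`; its elements denote full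
transformations. -/
def full (n : ℕ) : Submonoid (PIOPres n) :=
  Submonoid.closure {t | ∃ i, 1 ≤ i ∧ i < n ∧ (t = genA n i ∨ t = genB n i)}

theorem genA_mem_full (n i : ℕ) : genA n i ∈ full n := by
  by_cases hi : 1 ≤ i ∧ i < n
  · exact Submonoid.subset_closure ⟨i, hi.1, hi.2, Or.inl rfl⟩
  · rw [genA, dif_neg hi]
    exact one_mem _

theorem genB_mem_full (n i : ℕ) : genB n i ∈ full n := by
  by_cases hi : 1 ≤ i ∧ i < n
  · exact Submonoid.subset_closure ⟨i, hi.1, hi.2, Or.inr rfl⟩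
  · rw [genB, dif_neg hi]
    exact one_mem _

theorem zero_mul_of_mem_full {w : PIOPres n} (hw : w ∈ full n) : zero n * w = zero n := by
  induction hw using Submonoid.closure_induction_left with
  | one => rw [mul_one]
  | mul_left t ht w _ ih =>
    obtain ⟨i, hi, hin, rfl | rfl⟩ := ht
    · rw [← mul_assoc, zero_mul_genA hi hin, ih]
    · rw [← mul_assoc, zero_mul_genB hi hin, ih]

theorem act_pos_of_mem_full {w : PIOPres n} (hw : w ∈ full n) {x : ℕ} (hx₁ : 1 ≤ x)
    (hx : x ≤ n) : 1 ≤ act w x := by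
  induction hw using Submonoid.closure_induction generalizing x with
  | one => rwa [act_one hx]
  | mem t ht =>
    obtain ⟨i, hi, hin, rfl | rfl⟩ := ht
    · rw [act_genA hi hin]
      split_ifs <;> omega
    · rw [act_genB hi hin]
      split_ifs <;> omega
  | mul s t _ _ hs ht =>
    rw [act_mul]
    exact ht (hs hx₁ hx) (PT.val_le _ _)

/-- `g` restricts to a full order-preserving transformation of `{1, …, n}` whose image is an
interval. -/
structure IsFull (n : ℕ) (g : ℕ → ℕ) : Prop where
  pos : ∀ x, 1 ≤ x → x ≤ n → 1 ≤ g x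
  le : ∀ x, 1 ≤ x → x ≤ n → g x ≤ n
  step : ∀ x, 1 ≤ x → x < n → g (x + 1) = g x ∨ g (x + 1) = g x + 1

theorem isFull_act {w : PIOPres n} (hw : w ∈ full n) : IsFull n (act w) where
  pos _ := act_pos_of_mem_full hw
  le _ _ _ := PT.val_le _ _
  step x hx₁ hx := val_add_one_of_mem_PIOn (eval_mem w)
    (Nat.one_le_iff_ne_zero.1 (act_pos_of_mem_full hw hx₁ hx.le))
    (Nat.one_le_iff_ne_zero.1 (act_pos_of_mem_full hw (by omega) hx))

/-- The product, for `k = m, m - 1, …, 1` in this order, of the `a_k` such that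
`g (k + 1) = g k`. -/
def collapse (n : ℕ) (g : ℕ → ℕ) : ℕ → PIOPres n
  | 0 => 1
  | m + 1 => (if g (m + 2) = g (m + 1) then genA n (m + 1) else 1) * collapse n g m

/-- The normal form of the full transformation `g`: the `a_k` identify the points that `g`
identifies, and the power of `b_{n-1}` shifts the image to its place. -/
def normalForm (n : ℕ) (g : ℕ → ℕ) : PIOPres n :=
  collapse n g (n - 1) * genB n (n - 1) ^ (g 1 - 1)

theorem collapse_mem_full (n : ℕ) (g : ℕ → ℕ) (m : ℕ) : collapse n g m ∈ full n := by
  induction m with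
  | zero => exact one_mem _
  | succ m ih =>
    rw [collapse]
    split_ifs
    · exact mul_mem (genA_mem_full n _) ih
    · exact mul_mem (one_mem _) ih

theorem collapse_congr {g g' : ℕ → ℕ} {m : ℕ} (h : ∀ x, 1 ≤ x → x ≤ m + 1 → g x = g' x) :
    collapse n g m = collapse n g' m := by
  induction m with
  | zero => rfl
  | succ m ih =>
    rw [collapse, collapse, ih fun x h₁ h₂ => h x h₁ (by omega), h (m + 2) (by omega) (by omega),
      h (m + 1) (by omega) (by omega)]

theorem normalForm_congr {g g' : ℕ → ℕ} (hn : 1 ≤ n) (h : ∀ x, 1 ≤ x → x ≤ n → g x = g' x) :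
    normalForm n g = normalForm n g' := by
  rw [normalForm, normalForm, collapse_congr fun x h₁ h₂ => h x h₁ (by omega), h 1 le_rfl hn]

theorem genA_mul_collapse {g g' : ℕ → ℕ} {j m : ℕ} (hj : 1 ≤ j) (hjm : j ≤ m + 1) (hm : m + 2 ≤ n)
    (h₁ : ∀ x, x ≤ j → g' x = g x) (h₂ : ∀ x, j < x → x ≤ n → g' x = g (x - 1)) :
    genA n j * collapse n g m = collapse n g' (m + 1) := by
  obtain ⟨j, rfl⟩ : ∃ k, j = k + 1 := ⟨j - 1, by omega⟩
  induction m, (show j ≤ m by omega) using Nat.le_induction with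
  | base =>
    rw [collapse, if_pos ((h₂ _ (by omega) hm).trans (h₁ _ le_rfl).symm),
      collapse_congr fun x _ hx => (h₁ x hx).symm]
  | succ m hjm ih =>
    rw [collapse, collapse, ← ih (by omega) (by omega), h₂ _ (by omega) hm,
      h₂ _ (by omega) (by omega), Nat.add_sub_cancel, Nat.succ_sub_one]
    split_ifs
    · rw [← mul_assoc, genA_mul_genA hj (by omega) (by omega), mul_assoc]
    · rw [one_mul, one_mul]

theorem genA_mul_normalForm {j : ℕ} (hj : 1 ≤ j) (hjn : j < n) (g : ℕ → ℕ) :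
    genA n j * normalForm n g = normalForm n (g ∘ act (genA n j)) := by
  obtain ⟨m, rfl⟩ : ∃ m, n = m + 2 := ⟨n - 2, by omega⟩
  have h₁ (x : ℕ) (hx : x ≤ j) : (g ∘ act (genA (m + 2) j)) x = g x := by
    rw [Function.comp_apply, act_genA hj hjn, if_pos hx]
  have h₂ (x : ℕ) (hx : j < x) (hxm : x ≤ m + 2) :
      (g ∘ act (genA (m + 2) j)) x = g (x - 1) := by
    rw [Function.comp_apply, act_genA hj hjn, if_neg (by omega), if_pos hxm]
  rw [normalForm, normalForm, h₁ 1 hj, ← mul_assoc]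
  congr 1
  rw [show m + 2 - 1 = m + 1 from rfl, ← genA_mul_collapse hj (by omega) le_rfl h₁ h₂, collapse]
  split_ifs
  · rw [← mul_assoc]
    exact congrArg (· * _) (genA_mul_genA_last hj hjn)
  · rw [one_mul]

/- Moving `b_{n-1}` to the right through a collapse lowers the index of each factor by one; the
letters `a_{n-1}` that arise are absorbed by the factor to their left, initially `u`. -/
theorem mul_genB_last_mul_collapse {g g' : ℕ → ℕ} {m : ℕ} (hm : m + 2 ≤ n)
    (hg : ∀ x, 1 ≤ x → x < n → g' x = g (x + 1)) {u : PIOPres n} (hu : u * genA n (n - 1) = u) :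
    u * genB n (n - 1) * collapse n g (m + 1) =
      u * collapse n g' m * (if g 2 = g 1 then 1 else genB n (n - 1)) := by
  induction m generalizing u with
  | zero =>
    simp only [collapse, zero_add, mul_one]
    split_ifs
    · rw [mul_assoc, genB_mul_genA_one (by omega) (by omega), hu, mul_one]
    · rw [mul_one]
  | succ m ih =>
    rw [collapse, collapse.eq_2 n g' m, hg (m + 2) (by omega) (by omega),
      hg (m + 1) (by omega) (by omega)]
    by_cases h : g (m + 3) = g (m + 2)
    · have hu' : u * genA n (m + 1) * genA n (n - 1) = u * genA n (m + 1) := by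
        rw [mul_assoc, genA_mul_genA_last (by omega) (by omega)]
      have shift : u * genB n (n - 1) * genA n (m + 2) =
          u * genA n (m + 1) * genB n (n - 1) := by
        rw [mul_assoc, genB_last_mul_genA_succ (by omega) (by omega), ← mul_assoc, ← mul_assoc, hu]
      rw [if_pos h, if_pos h, ← mul_assoc, ← mul_assoc, shift, ih (by omega) hu']
    · rw [if_neg h, if_neg h, one_mul, one_mul, ih (by omega) hu]

theorem genB_last_mul_normalForm (hn : 2 ≤ n) {g : ℕ → ℕ} (hg : IsFull n g) :
    genB n (n - 1) * normalForm n g = normalForm n (g ∘ act (genB n (n - 1))) := by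
  obtain ⟨m, rfl⟩ : ∃ m, n = m + 2 := ⟨n - 2, by omega⟩
  set g' := g ∘ act (genB (m + 2) (m + 2 - 1)) with hg'
  have g'_of_lt (x : ℕ) (hx₁ : 1 ≤ x) (hx : x < m + 2) : g' x = g (x + 1) := by
    rw [hg', Function.comp_apply, act_genB (by omega) (by omega), if_neg (by omega),
      if_pos (by omega)]
  have g'_last : g' (m + 2) = g (m + 2) := by
    rw [hg', Function.comp_apply, act_genB (by omega) (by omega), if_neg (by omega),
      if_neg (by omega), if_pos le_rfl]
  have collapse_g' :
      collapse (m + 2) g' (m + 1) = genA (m + 2) (m + 1) * collapse (m + 2) g' m := by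
    rw [collapse, if_pos (by rw [g'_last, g'_of_lt _ (by omega) (by omega)])]
  have key : genB (m + 2) (m + 1) * collapse (m + 2) g (m + 1) = collapse (m + 2) g' (m + 1) *
      if g 2 = g 1 then 1 else genB (m + 2) (m + 1) := by
    have h := mul_genB_last_mul_collapse le_rfl g'_of_lt (u := genA (m + 2) (m + 1))
      (genA_mul_genA_last (by omega) (by omega))
    rw [genA_mul_genB_last (by omega) (by omega)] at h
    rw [collapse_g']
    exact h
  have pow_eq : (if g 2 = g 1 then 1 else genB (m + 2) (m + 1)) * genB (m + 2) (m + 1) ^ (g 1 - 1) =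
      genB (m + 2) (m + 1) ^ (g 2 - 1) := by
    have hpos := hg.pos 1 le_rfl (by omega)
    have hstep : g 2 = g 1 ∨ g 2 = g 1 + 1 := hg.step 1 le_rfl (by omega)
    rcases hstep with h | h
    · rw [if_pos h, one_mul, h]
    · rw [if_neg (by omega), ← pow_succ', h, Nat.sub_add_cancel hpos, Nat.add_sub_cancel]
  rw [normalForm, normalForm, g'_of_lt 1 le_rfl (by omega), show m + 2 - 1 = m + 1 from rfl,
    ← mul_assoc, key, mul_assoc, pow_eq]

theorem normalForm_act_one (hn : 1 ≤ n) : normalForm n (act (1 : PIOPres n)) = 1 := by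
  have collapse_one (m : ℕ) (hm : m < n) : collapse n (act (1 : PIOPres n)) m = 1 := by
    induction m with
    | zero => rfl
    | succ m ih =>
      rw [collapse, ih (by omega), act_one (by omega), act_one (by omega), if_neg (by omega),
        one_mul]
  rw [normalForm, collapse_one _ (by omega), act_one hn, Nat.sub_self, pow_zero, one_mul]

theorem eq_normalForm_act (hn : 2 ≤ n) {w : PIOPres n} (hw : w ∈ full n) :
    w = normalForm n (act w) := by
  induction hw using Submonoid.closure_induction_left with
  | one => exact (normalForm_act_one (by omega)).symm
  | mul_left t ht w hw ih =>
    obtain ⟨i, hi, hin, rfl | rfl⟩ := ht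
    · rw [act_mul, ← genA_mul_normalForm hi hin, ← ih]
    · rw [← genA_mul_genB_last hi hin, mul_assoc, act_mul, ← genA_mul_normalForm hi hin, act_mul,
        ← genB_last_mul_normalForm hn (isFull_act hw), ← ih]

theorem eq_of_act_eq_of_mem_full (hn : 2 ≤ n) {w w' : PIOPres n} (hw : w ∈ full n)
    (hw' : w' ∈ full n) (h : ∀ x, 1 ≤ x → x ≤ n → act w x = act w' x) : w = w' := by
  rw [eq_normalForm_act hn hw, eq_normalForm_act hn hw']
  exact normalForm_congr (by omega) h

theorem act_collapse {g : ℕ → ℕ} (hg : IsFull n g) {m : ℕ} (hm : m < n) {x : ℕ} (hx₁ : 1 ≤ x)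
    (hx : x ≤ n) :
    act (collapse n g m) x + g 1 = g (min x (m + 1)) + (x - min x (m + 1)) + 1 := by
  induction m generalizing x with
  | zero =>
    rw [collapse, act_one hx, show min x (0 + 1) = 1 by omega]
    omega
  | succ m ih =>
    rw [collapse, act_mul, Function.comp_apply]
    rcases le_or_gt x (m + 1) with hxm | hxm
    · have fixed : act (if g (m + 2) = g (m + 1) then genA n (m + 1) else 1) x = x := by
        split_ifs
        · rw [act_genA (by omega) hm, if_pos hxm]
        · exact act_one hx
      rw [fixed, ih (by omega) hx₁ hx, min_eq_left hxm, min_eq_left (by omega)]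
    · rw [show min x (m + 1 + 1) = m + 2 by omega]
      split_ifs with h
      · rw [act_genA (by omega) hm, if_neg (by omega), if_pos hx,
          ih (by omega) (by omega) (by omega), show min (x - 1) (m + 1) = m + 1 by omega, h]
        omega
      · rw [act_one hx, ih (by omega) hx₁ hx, show min x (m + 1) = m + 1 by omega]
        have hstep : g (m + 2) = g (m + 1) ∨ g (m + 2) = g (m + 1) + 1 :=
          hg.step (m + 1) (by omega) hm
        omega

theorem act_normalForm (hn : 2 ≤ n) {g : ℕ → ℕ} (hg : IsFull n g) {x : ℕ} (hx₁ : 1 ≤ x)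
    (hx : x ≤ n) : act (normalForm n g) x = g x := by
  have hcollapse := act_collapse hg (m := n - 1) (by omega) hx₁ hx
  rw [show min x (n - 1 + 1) = x by omega] at hcollapse
  have hpos := act_pos_of_mem_full (collapse_mem_full n g (n - 1)) hx₁ hx
  have hg₁ := hg.pos 1 le_rfl (by omega)
  have hgx := hg.le x hx₁ hx
  rw [normalForm, act_mul, Function.comp_apply,
    act_genB_pow (by omega) (by omega) _ hpos (PT.val_le _ _)]
  omega

end PIOPres

/-! ### Reduction to a partial identity followed by a full transformation -/

namespace PIOPres

variable {n : ℕ}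

/-- `t` is the zero, or the identity on an interval `{p, …, q}` followed by a full
transformation. -/
def IsReduced (t : PIOPres n) : Prop :=
  t = zero n ∨ ∃ p q w, 1 ≤ p ∧ p ≤ q ∧ q ≤ n ∧ w ∈ full n ∧ t = genE n q * genF n p * w

theorem isReduced_zero_mul {w : PIOPres n} (hw : w ∈ full n) : IsReduced (zero n * w) :=
  Or.inl (zero_mul_of_mem_full hw)

theorem isReduced_genE_mul_genF_mul (hn : 1 ≤ n) {p q : ℕ} (hq : 1 ≤ q) (hp : p ≤ n)
    {w : PIOPres n} (hw : w ∈ full n) : IsReduced (genE n q * genF n p * w) := by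
  rcases lt_or_ge q p with hqp | hpq
  · rw [genE_mul_genF_of_lt hq hqp hp]
    exact isReduced_zero_mul hw
  · refine Or.inr ⟨max p 1, min q n, w, by omega, by omega, by omega, hw, ?_⟩
    have genE_min : genE n (min q n) = genE n q := by
      rw [← genE_mul_genE hq (by omega), genE_of_le (i := n) le_rfl, mul_one]
    have genF_max : genF n (max p 1) = genF n p := by
      rw [← genF_mul_genF hp (by omega), genF_of_le_one (j := 1) le_rfl, mul_one]
    rw [genE_min, genF_max]

theorem isReduced_genE_mul_genA_mul_genF_mul {i p q : ℕ} (hi : 1 ≤ i) (hin : i < n) (hp : p ≤ n)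
    (hq : 1 ≤ q) {w : PIOPres n} (hw : w ∈ full n) :
    IsReduced (genE n q * (genA n i * genF n p) * w) := by
  have haw : genA n i * w ∈ full n := mul_mem (genA_mem_full n i) hw
  obtain hpi | ⟨hpi, hpn⟩ | rfl : p ≤ i ∨ (i < p ∧ p < n) ∨ p = n := by omega
  · rw [genA_mul_genF_of_le hpi hin, ← mul_assoc, mul_assoc _ _ w]
    exact isReduced_genE_mul_genF_mul (by omega) hq hp haw
  · rw [genA_mul_genF_of_lt hi hpi hpn, ← mul_assoc, mul_assoc _ _ w]
    exact isReduced_genE_mul_genF_mul (by omega) hq hpn haw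
  · rw [genA_mul_genF_last hi hin, genE_mul_zero hq]
    exact isReduced_zero_mul hw

theorem isReduced_genE_mul_genB_mul_genF_mul {i p q : ℕ} (hi : 1 ≤ i) (hin : i < n) (hp : p ≤ n)
    (hq : 1 ≤ q) {w : PIOPres n} (hw : w ∈ full n) :
    IsReduced (genE n q * (genB n i * genF n p) * w) := by
  rcases le_or_gt p (i + 1) with hpi | hpi
  · rw [genB_mul_genF_of_le hpi hin, ← mul_assoc, mul_assoc _ _ w]
    exact isReduced_genE_mul_genF_mul (by omega) hq (by omega) (mul_mem (genB_mem_full n i) hw)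
  · rw [genB_mul_genF_of_lt hi hpi hp]
    exact isReduced_genE_mul_genF_mul (by omega) hq hp hw

namespace IsReduced

variable {t : PIOPres n}

theorem genA_mul (ht : IsReduced t) {i : ℕ} (hi : 1 ≤ i) (hin : i < n) :
    IsReduced (genA n i * t) := by
  obtain rfl | ⟨p, q, w, hp, hpq, hqn, hw, rfl⟩ := ht
  · exact Or.inl (genA_mul_zero hi hin)
  rw [← mul_assoc, ← mul_assoc]
  rcases le_or_gt i q with hiq | hqi
  · rw [genA_mul_genE_of_le hi hiq, mul_assoc (genE _ _)]
    exact isReduced_genE_mul_genA_mul_genF_mul hi hin (by omega) (by omega) hw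
  · rw [genA_mul_genE_of_lt (by omega) hqi hin]
    exact isReduced_genE_mul_genF_mul (by omega) (by omega) (by omega) hw

theorem genB_mul (ht : IsReduced t) {i : ℕ} (hi : 1 ≤ i) (hin : i < n) :
    IsReduced (genB n i * t) := by
  obtain rfl | ⟨p, q, w, hp, hpq, hqn, hw, rfl⟩ := ht
  · exact Or.inl (genB_mul_zero hi hin)
  rw [← mul_assoc, ← mul_assoc]
  obtain hiq | ⟨hq, hqi⟩ | rfl : i < q ∨ (2 ≤ q ∧ q ≤ i) ∨ q = 1 := by omega
  · rw [genB_mul_genE_of_lt hi hiq, mul_assoc (genE _ _)]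
    exact isReduced_genE_mul_genB_mul_genF_mul hi hin (by omega) (by omega) hw
  · rw [genB_mul_genE_of_le hq hqi hin, mul_assoc (genE _ _)]
    exact isReduced_genE_mul_genB_mul_genF_mul hi hin (by omega) (by omega) hw
  · rw [genB_mul_genE_one hi hin, zero_mul_genF (by omega) (by omega)]
    exact isReduced_zero_mul hw

theorem genE_mul (ht : IsReduced t) {i : ℕ} (hi : 1 ≤ i) : IsReduced (genE n i * t) := by
  obtain rfl | ⟨p, q, w, hp, hpq, hqn, hw, rfl⟩ := ht
  · exact Or.inl (genE_mul_zero hi)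
  rw [← mul_assoc, ← mul_assoc, genE_mul_genE hi (by omega)]
  exact isReduced_genE_mul_genF_mul (by omega) (by omega) (by omega) hw

theorem genF_mul (ht : IsReduced t) {j : ℕ} (hj : 2 ≤ j) (hjn : j ≤ n) :
    IsReduced (genF n j * t) := by
  obtain rfl | ⟨p, q, w, hp, hpq, hqn, hw, rfl⟩ := ht
  · exact Or.inl (genF_mul_zero hjn)
  rw [← mul_assoc, ← mul_assoc]
  rcases le_or_gt j q with hjq | hqj
  · rw [genF_mul_genE (by omega), mul_assoc (genE _ _), genF_mul_genF hjn (by omega)]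
    exact isReduced_genE_mul_genF_mul (by omega) (by omega) (by omega) hw
  · rw [genF_mul_genE_of_lt (by omega) hqj hjn, zero_mul_genF (by omega) (by omega)]
    exact isReduced_zero_mul hw

end IsReduced

theorem isReduced (hn : 1 ≤ n) (t : PIOPres n) : IsReduced t := by
  refine Submonoid.induction_of_closure_eq_top_left (PresentedMonoid.closure_range_of _) t ?_ ?_
  · exact Or.inr ⟨1, n, 1, le_rfl, hn, le_rfl, one_mem _, by
      rw [genE_of_le le_rfl, genF_of_le_one le_rfl, mul_one, mul_one]⟩
  · rintro _ ⟨x, rfl⟩ t ht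
    cases x with
    | a i hi =>
      change IsReduced (mk n (wa i hi) * t)
      rw [mk_wa]
      exact ht.genA_mul hi.1 hi.2
    | b i hi =>
      change IsReduced (mk n (wb i hi) * t)
      rw [mk_wb]
      exact ht.genB_mul hi.1 hi.2
    | e i hi =>
      change IsReduced (mk n (we i hi) * t)
      rw [mk_we]
      exact ht.genE_mul hi.1
    | f j hj =>
      change IsReduced (mk n (wf j hj) * t)
      rw [mk_wf]
      exact ht.genF_mul hj.1 hj.2

/-! ### Faithfulness of the action -/

/-- The full transformation that moves every point to the nearest point of `{p, …, q}`. -/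
def clamp (n p q : ℕ) : PIOPres n := genB n (p - 1) ^ (p - 1) * genA n q ^ (n - q)

theorem clamp_mem_full (n p q : ℕ) : clamp n p q ∈ full n :=
  mul_mem (pow_mem (genB_mem_full _ _) _) (pow_mem (genA_mem_full _ _) _)

theorem genE_mul_genF_mul_clamp {p q : ℕ} (hp : 1 ≤ p) (hpq : p ≤ q) (hqn : q ≤ n) :
    genE n q * genF n p * clamp n p q = genE n q * genF n p := by
  have mul_pow_of_mul {s t : PIOPres n} (h : s * t = s) (k : ℕ) : s * t ^ k = s := by
    induction k with
    | zero => rw [pow_zero, mul_one]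
    | succ k ih => rw [pow_succ', ← mul_assoc, h, ih]
  have hB : genF n p * genB n (p - 1) ^ (p - 1) = genF n p := by
    rcases hp.eq_or_lt with rfl | hp
    · rw [Nat.sub_self, pow_zero, mul_one]
    obtain ⟨i, rfl⟩ : ∃ i, p = i + 1 := ⟨p - 1, by omega⟩
    exact mul_pow_of_mul (genF_succ_mul_genB (by omega) (by omega)) _
  have hA : genE n q * genA n q ^ (n - q) = genE n q := by
    rcases hqn.eq_or_lt with rfl | hq
    · rw [Nat.sub_self, pow_zero, mul_one]
    exact mul_pow_of_mul (genE_mul_genA (by omega) hq) _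
  rw [clamp, ← mul_assoc, mul_assoc (genE n q), hB, ← genF_mul_genE (by omega), mul_assoc, hA]

theorem act_clamp {p q : ℕ} (hp : 1 ≤ p) (hpq : p ≤ q) (hqn : q ≤ n) {x : ℕ} (hx₁ : 1 ≤ x)
    (hx : x ≤ n) : act (clamp n p q) x = min (max x p) q := by
  have hB : act (genB n (p - 1) ^ (p - 1)) x = max x p := by
    rcases hp.eq_or_lt with rfl | hp
    · rw [Nat.sub_self, pow_zero, act_one hx, max_eq_left hx₁]
    · rw [act_genB_pow (by omega) (by omega) _ hx₁ hx]
      omega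
  rw [clamp, act_mul, Function.comp_apply, hB]
  rcases hqn.eq_or_lt with rfl | hq
  · rw [Nat.sub_self, pow_zero, act_one (by omega), min_eq_left (by omega)]
  · rw [act_genA_pow (by omega) hq _ (by omega)]
    omega

theorem genE_mul_genF_mul_congr (hn : 2 ≤ n) {p q : ℕ} (hp : 1 ≤ p) (hpq : p ≤ q) (hqn : q ≤ n)
    {w w' : PIOPres n} (hw : w ∈ full n) (hw' : w' ∈ full n)
    (h : ∀ x, p ≤ x → x ≤ q → act w x = act w' x) :
    genE n q * genF n p * w = genE n q * genF n p * w' := by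
  rw [← genE_mul_genF_mul_clamp hp hpq hqn, mul_assoc _ _ w, mul_assoc _ _ w']
  congr 1
  refine eq_of_act_eq_of_mem_full hn (mul_mem (clamp_mem_full _ _ _) hw)
    (mul_mem (clamp_mem_full _ _ _) hw') fun x hx₁ hx => ?_
  rw [act_mul, act_mul, Function.comp_apply, Function.comp_apply, act_clamp hp hpq hqn hx₁ hx]
  exact h _ (by omega) (by omega)

theorem act_genE_mul_genF_mul_pos_iff {p q : ℕ} (hq : 1 ≤ q) (hp : p ≤ n) {w : PIOPres n}
    (hw : w ∈ full n) {x : ℕ} (hx₁ : 1 ≤ x) (hx : x ≤ n) :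
    1 ≤ act (genE n q * genF n p * w) x ↔ p ≤ x ∧ x ≤ q := by
  have hpos := act_pos_of_mem_full hw hx₁ hx
  rw [act_genE_mul_genF_mul hq hp w hx]
  split_ifs with h
  · exact iff_of_true hpos h
  · exact iff_of_false (by omega) h

theorem zero_ne_genE_mul_genF_mul (hn : 2 ≤ n) {p q : ℕ} (hp : 1 ≤ p) (hpq : p ≤ q) (hqn : q ≤ n)
    {w : PIOPres n} (hw : w ∈ full n) : act (zero n) ≠ act (genE n q * genF n p * w) := by
  intro h
  have hpos := (act_genE_mul_genF_mul_pos_iff (by omega) (by omega) hw hp (by omega)).2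
    ⟨le_rfl, hpq⟩
  rw [← h, act_zero hn (by omega)] at hpos
  omega

theorem act_injective (hn : 2 ≤ n) : Function.Injective (act (n := n)) := by
  intro s t hst
  obtain rfl | ⟨p, q, w, hp, hpq, hqn, hw, rfl⟩ := isReduced (by omega) s <;>
  obtain rfl | ⟨p', q', w', hp', hpq', hqn', hw', rfl⟩ := isReduced (by omega) t
  · rfl
  · exact absurd hst (zero_ne_genE_mul_genF_mul hn hp' hpq' hqn' hw')
  · exact absurd hst.symm (zero_ne_genE_mul_genF_mul hn hp hpq hqn hw)
  · have hdom (x : ℕ) (hx₁ : 1 ≤ x) (hx : x ≤ n) : p ≤ x ∧ x ≤ q ↔ p' ≤ x ∧ x ≤ q' := by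
      rw [← act_genE_mul_genF_mul_pos_iff (by omega) (by omega) hw hx₁ hx, hst,
        act_genE_mul_genF_mul_pos_iff (by omega) (by omega) hw' hx₁ hx]
    have hp_mem := hdom p hp (by omega)
    have hp'_mem := hdom p' hp' (by omega)
    have hq_mem := hdom q (by omega) hqn
    have hq'_mem := hdom q' (by omega) hqn'
    obtain rfl : p = p' := by omega
    obtain rfl : q = q' := by omega
    refine genE_mul_genF_mul_congr hn hp hpq hqn hw hw' fun x hpx hxq => ?_
    have h := congrFun hst x
    rwa [act_genE_mul_genF_mul (by omega) (by omega) _ (by omega),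
      act_genE_mul_genF_mul (by omega) (by omega) _ (by omega), if_pos ⟨hpx, hxq⟩,
      if_pos ⟨hpx, hxq⟩] at h

theorem eval_injective (hn : 2 ≤ n) : Function.Injective (eval n) :=
  fun _ _ h => act_injective hn (congrArg PT.val h)

/-! ### Surjectivity of the action -/

theorem exists_eval_eq (hn : 2 ≤ n) {α : PT n} (hα : α ∈ PIOn n) : ∃ t, eval n t = α := by
  obtain ⟨p, q, hp, hqn, hdom⟩ := exists_val_ne_zero_iff_of_mem_PIOn hα
  rcases le_or_gt p q with hpq | hqp
  · have hfull : IsFull n fun x => α.val (min (max x p) q) := by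
      refine ⟨fun x _ _ => ?_, fun x _ _ => α.val_le _, fun x _ _ => ?_⟩
      · exact Nat.one_le_iff_ne_zero.2 ((hdom _).2 (by omega))
      · by_cases hx : p ≤ x ∧ x < q
        · rw [show min (max (x + 1) p) q = x + 1 by omega, show min (max x p) q = x by omega]
          exact val_add_one_of_mem_PIOn hα ((hdom x).2 (by omega)) ((hdom _).2 (by omega))
        · exact Or.inl (by rw [show min (max (x + 1) p) q = min (max x p) q by omega])
    refine ⟨genE n q * genF n p * normalForm n fun x => α.val (min (max x p) q),
      PT.ext_val fun x hx₁ hx => ?_⟩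
    refine (act_genE_mul_genF_mul (by omega) (by omega) _ hx).trans ?_
    split_ifs with hpxq
    · rw [act_normalForm hn hfull hx₁ hx, show min (max x p) q = x by omega]
    · exact (not_not.1 (mt (hdom x).1 hpxq)).symm
  · refine ⟨zero n, PT.ext_val fun x _ hx => (act_zero hn hx).trans ?_⟩
    exact (not_not.1 (mt (hdom x).1 (by omega))).symm

theorem mrange_eval (hn : 2 ≤ n) : MonoidHom.mrange (eval n) = PIOn n :=
  le_antisymm (mrange_eval_le n) fun _ => exists_eval_eq hn

end PIOPres

theorem definedBy_PIORelations {n : ℕ} (hn : 2 ≤ n) :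
    DefinedBy (PIOn n) PIOLetter.toPT (PIORelations n) :=
  definedBy_iff.2 ⟨satisfies_PIORelations n, PIOPres.eval_injective hn, PIOPres.mrange_eval hn⟩

/-! ### From a presentation of `PIOn n` to a presentation of `PIMn n` -/

section Extension

variable {n : ℕ} {R' : Relations (PIOLetter n)}

theorem lift_map_of (u : FreeMonoid (PIOLetter n)) :
    FreeMonoid.lift PIMLetter.toPT (FreeMonoid.map PIMLetter.of u) =
      FreeMonoid.lift PIOLetter.toPT u :=
  DFunLike.congr_fun (FreeMonoid.hom_eq
    (f := (FreeMonoid.lift PIMLetter.toPT).comp (FreeMonoid.map PIMLetter.of))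
    (g := FreeMonoid.lift PIOLetter.toPT) fun _ => rfl) u

theorem PIMLetter.toPT_of (x : PIOLetter n) : (of x).toPT = x.toPT := rfl

theorem satisfies_NRel (n : ℕ) : Satisfies PIMLetter.toPT {p | NRel n p.1 p.2} := by
  intro u v (h : NRel n u v)
  cases h with
  | N0 => rw [map_mul, FreeMonoid.lift_eval_of, PIMLetter.h_mul_h, map_one]
  | N1 i hi hin =>
    refine PT.ext_val fun x hx₁ hx => ?_
    simp only [map_mul, FreeMonoid.lift_eval_of, PT.val_mul, PIMLetter.toPT_of, PIMLetter.val_h,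
      PIOLetter.val_a, PIOLetter.val_b]
    grind
  | N1' i hi hin =>
    refine PT.ext_val fun x hx₁ hx => ?_
    simp only [map_mul, FreeMonoid.lift_eval_of, PT.val_mul, PIMLetter.toPT_of, PIMLetter.val_h,
      PIOLetter.val_e, PIOLetter.val_f]
    grind
  | N2 hn =>
    refine PT.ext_val fun x hx₁ hx => ?_
    simp only [map_mul, map_pow, FreeMonoid.lift_eval_of, PT.val_mul, PIMLetter.toPT_of,
      PIMLetter.val_h, PIOLetter.val_a_pow _ _ _ hx, PIOLetter.val_b_pow _ _ _ hx₁ hx]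
    grind

theorem satisfies_RHat (hR : Satisfies PIOLetter.toPT R') :
    Satisfies PIMLetter.toPT (RHat n R') := by
  rintro u v (⟨⟨u, v⟩, huv, h⟩ | h)
  · obtain ⟨rfl, rfl⟩ := Prod.mk.inj h
    rw [lift_map_of, lift_map_of, hR u v huv]
  · exact satisfies_NRel n u v h

namespace RHatPres

/-- The class of a word in the monoid presented by `RHat n R'`. -/
abbrev mk (R' : Relations (PIOLetter n)) : FreeMonoid (PIMLetter n) →* Presented (RHat n R') :=
  PresentedMonoid.mk _

/-- The homomorphism between the presented monoids induced by the inclusion of the alphabets. -/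
def incl (R' : Relations (PIOLetter n)) : Presented R' →* Presented (RHat n R') :=
  PresentedMonoid.lift (fun x => mk R' (FreeMonoid.of (.of x))) fun u v huv => by
    have lift_eq (w) : FreeMonoid.lift (fun x => mk R' (FreeMonoid.of (.of x))) w =
        mk R' (FreeMonoid.map PIMLetter.of w) :=
      DFunLike.congr_fun (FreeMonoid.hom_eq (f := FreeMonoid.lift _)
        (g := (mk R').comp (FreeMonoid.map PIMLetter.of)) fun _ => rfl) w
    rw [lift_eq, lift_eq]
    exact PresentedMonoid.mk_eq_mk_of_rel (rels := fun u v => (u, v) ∈ RHat n R')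
      (Or.inl ⟨(u, v), huv, rfl⟩)

/-- The class of `h`. -/
def refl (R' : Relations (PIOLetter n)) : Presented (RHat n R') := mk R' (FreeMonoid.of .h)

/-- The class of `x` in `Presented R'`. -/
abbrev of (R' : Relations (PIOLetter n)) (x : PIOLetter n) : Presented R' := PresentedMonoid.of _ x

theorem mk_eq_mk {u v : FreeMonoid (PIMLetter n)} (h : NRel n u v) : mk R' u = mk R' v :=
  PresentedMonoid.mk_eq_mk_of_rel (rels := fun u v => (u, v) ∈ RHat n R') (Or.inr h)

theorem refl_mul_refl : refl R' * refl R' = 1 := mk_eq_mk NRel.N0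

theorem refl_mul_incl_a (i : ℕ) (hi : 1 ≤ i ∧ i < n) :
    refl R' * incl R' (of R' (.a i hi)) =
      incl R' (of R' (.b (n - i) (by omega))) * refl R' :=
  mk_eq_mk (NRel.N1 i hi.1 hi.2)

theorem refl_mul_incl_e (i : ℕ) (hi : 1 ≤ i ∧ i < n) :
    refl R' * incl R' (of R' (.e i hi)) =
      incl R' (of R' (.f (n - i + 1) (by omega))) * refl R' :=
  mk_eq_mk (NRel.N1' i hi.1 hi.2)

theorem incl_a_pow_mul_refl (hn : 2 ≤ n) :
    incl R' (of R' (.a 1 (by omega)) ^ (n - 1)) * refl R' =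
      incl R' (of R' (.b (n - 1) (by omega)) ^ (n - 1)) := by
  rw [map_pow, map_pow]
  exact mk_eq_mk (NRel.N2 hn)

theorem exists_refl_mul_incl_of (x : PIOLetter n) :
    ∃ s, refl R' * incl R' (of R' x) = incl R' s * refl R' := by
  cases x with
  | a i hi => exact ⟨_, refl_mul_incl_a i hi⟩
  | b i hi =>
    refine ⟨of R' (.a (n - i) (by omega)), mul_eq_mul_of_mul_self_eq_one refl_mul_refl ?_⟩
    simp only [refl_mul_incl_a, Nat.sub_sub_self hi.2.le]
  | e i hi => exact ⟨_, refl_mul_incl_e i hi⟩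
  | f j hj =>
    refine ⟨of R' (.e (n - j + 1) (by omega)), mul_eq_mul_of_mul_self_eq_one refl_mul_refl ?_⟩
    simp only [refl_mul_incl_e, show n - (n - j + 1) + 1 = j by omega]

theorem exists_refl_mul_incl (s : Presented R') :
    ∃ s', refl R' * incl R' s = incl R' s' * refl R' :=
  exists_mul_map_eq_of_closure (PresentedMonoid.closure_range_of _)
    (Set.forall_mem_range.2 exists_refl_mul_incl_of) s

theorem closure_insert_refl_range_incl :
    Submonoid.closure (insert (refl R') (Set.range (incl R'))) = ⊤ := by
  rw [eq_top_iff, ← PresentedMonoid.closure_range_of]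
  refine Submonoid.closure_mono (Set.range_subset_iff.2 fun x => ?_)
  cases x with
  | of x => exact Or.inr ⟨of R' x, rfl⟩
  | h => exact Or.inl rfl

theorem eval_incl (hR : Satisfies PIOLetter.toPT R') (s : Presented R') :
    (satisfies_RHat hR).eval (incl R' s) = hR.eval s :=
  DFunLike.congr_fun (PresentedMonoid.ext _
    (φ := (satisfies_RHat hR).eval.comp (incl R')) (ψ := hR.eval) fun _ => rfl) s

theorem eval_refl (hR : Satisfies PIOLetter.toPT R') :
    (satisfies_RHat hR).eval (refl R') = (PIMLetter.h : PIMLetter n).toPT := rfl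

/- If both `α` and `αh` are order-preserving then `α` is constant on its domain, so it factors
through the constant transformation `a_1^{n-1}`. -/
theorem exists_eq_mul_a_pow_mul (hn : 2 ≤ n) (hR : Satisfies PIOLetter.toPT R')
    (hinj : Function.Injective hR.eval) {s : Presented R'} (hs : hR.eval s ∈ PIOn n)
    (hsh : hR.eval s * (PIMLetter.h : PIMLetter n).toPT ∈ PIOn n) :
    ∃ s₂, s = s * of R' (.a 1 (by omega)) ^ (n - 1) * s₂ := by
  obtain ⟨d, hd, hdn, hval⟩ := exists_val_eq_zero_or_eq_of_mul_h_mem_PIOn (by omega) hs hsh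
  refine ⟨of R' (.b (n - 1) (by omega)) ^ (d - 1), hinj (PT.ext_val fun x _ _ => ?_)⟩
  rw [map_mul, map_mul, map_pow, map_pow, hR.eval_of, hR.eval_of, PT.val_mul, PT.val_mul]
  rcases hval x with h | h
  · rw [h, PT.val_zero, PT.val_zero]
  · rw [h, PIOLetter.val_a_pow _ _ _ hdn, PIOLetter.val_b_pow _ _ _ (by omega) (by omega)]
    omega

theorem eval_injective (hn : 2 ≤ n) (hR : Satisfies PIOLetter.toPT R')
    (hinj : Function.Injective hR.eval) (hrange : MonoidHom.mrange hR.eval = PIOn n) :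
    Function.Injective (satisfies_RHat hR).eval := by
  have mem_PIOn (s : Presented R') : hR.eval s ∈ PIOn n := hrange ▸ ⟨s, rfl⟩
  refine injective_of_involution refl_mul_refl exists_refl_mul_incl
    (exists_eq_map_or_eq_map_mul refl_mul_refl exists_refl_mul_incl closure_insert_refl_range_incl)
    (incl_a_pow_mul_refl hn) ?_ fun s s' h => ?_
  · intro s t hst
    exact hinj (by rwa [← eval_incl hR, ← eval_incl hR])
  · rw [map_mul, eval_incl hR, eval_incl hR, eval_refl hR] at h
    obtain ⟨s₂, hs⟩ := exists_eq_mul_a_pow_mul hn hR hinj (mem_PIOn s) (h ▸ mem_PIOn s')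
    exact ⟨s, s₂, hs⟩

theorem mrange_eval (hR : Satisfies PIOLetter.toPT R')
    (hrange : MonoidHom.mrange hR.eval = PIOn n) :
    MonoidHom.mrange (satisfies_RHat hR).eval = PIMn n := by
  refine le_antisymm ?_ fun α hα => ?_
  · rw [Satisfies.mrange_eval, Submonoid.closure_le]
    exact Set.range_subset_iff.2 PIMLetter.toPT_mem
  · rw [mem_PIMn_iff_mem_PIOn_or, ← hrange] at hα
    rcases hα with ⟨s, rfl⟩ | ⟨s, hs⟩
    · exact ⟨incl R' s, eval_incl hR s⟩
    · refine ⟨incl R' s * refl R', ?_⟩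
      rw [map_mul, eval_incl hR, eval_refl hR, hs, mul_assoc, PIMLetter.h_mul_h, mul_one]

end RHatPres

theorem definedBy_RHat (hn : 2 ≤ n) (hR : DefinedBy (PIOn n) PIOLetter.toPT R') :
    DefinedBy (PIMn n) PIMLetter.toPT (RHat n R') := by
  obtain ⟨hsat, hinj, hrange⟩ := definedBy_iff.1 hR
  exact definedBy_iff.2 ⟨satisfies_RHat hsat, RHatPres.eval_injective hn hsat hinj hrange,
    RHatPres.mrange_eval hsat hrange⟩

end Extension

/-! ### Counting letters and relations -/

section Counting

variable {n : ℕ}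

/-- Each of the four kinds of letters is indexed by `n - 1` numbers. -/
def PIOLetter.equivSum (n : ℕ) :
    PIOLetter n ≃ (Fin (n - 1) ⊕ Fin (n - 1)) ⊕ (Fin (n - 1) ⊕ Fin (n - 1)) where
  toFun
    | .a i hi => .inl (.inl ⟨i - 1, by omega⟩)
    | .b i hi => .inl (.inr ⟨i - 1, by omega⟩)
    | .e i hi => .inr (.inl ⟨i - 1, by omega⟩)
    | .f j hj => .inr (.inr ⟨j - 2, by omega⟩)
  invFun
    | .inl (.inl i) => .a (i + 1) (by omega)
    | .inl (.inr i) => .b (i + 1) (by omega)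
    | .inr (.inl i) => .e (i + 1) (by omega)
    | .inr (.inr i) => .f (i + 2) (by omega)
  left_inv x := by
    cases x <;> simp only [a.injEq, b.injEq, e.injEq, f.injEq] <;> omega
  right_inv x := by
    rcases x with (i | i) | (i | i) <;> rfl

instance : Fintype (PIOLetter n) := Fintype.ofEquiv _ (PIOLetter.equivSum n).symm

theorem PIOLetter.sum_eq (g : PIOLetter n → ℕ) :
    ∑ x, g x = ∑ i : Fin (n - 1), (g (.a (i + 1) (by omega)) + g (.b (i + 1) (by omega)) +
      g (.e (i + 1) (by omega)) + g (.f (i + 2) (by omega))) := by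
  rw [← (equivSum n).symm.sum_comp, Fintype.sum_sum_type, Fintype.sum_sum_type,
    Fintype.sum_sum_type]
  simp only [Finset.sum_add_distrib, ← add_assoc]
  rfl

/-- The larger alphabet has one more letter. -/
def PIMLetter.equivOption (n : ℕ) : PIMLetter n ≃ Option (PIOLetter n) where
  toFun
    | .of x => some x
    | .h => none
  invFun
    | some x => .of x
    | none => .h
  left_inv x := by cases x <;> rfl
  right_inv x := by cases x <;> rfl

theorem PIMLetter.nat_card (hn : 2 ≤ n) : Nat.card (PIMLetter n) = 4 * n - 3 := by
  rw [Nat.card_congr ((PIMLetter.equivOption n).trans (PIOLetter.equivSum n).optionCongr)]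
  simp only [Nat.card_eq_fintype_card, Fintype.card_option, Fintype.card_sum, Fintype.card_fin]
  omega

theorem PIMLetter.toPT_injective (hn : 2 ≤ n) : Function.Injective (toPT (n := n)) := by
  intro x y hxy
  have val_eq (k : ℕ) : x.toPT.val k = y.toPT.val k := by rw [hxy]
  have h₁ := val_eq 1
  have hₙ := val_eq n
  rcases x with ⟨⟨i, hi⟩ | ⟨i, hi⟩ | ⟨i, hi⟩ | ⟨i, hi⟩⟩ | _ <;>
  rcases y with ⟨⟨j, hj⟩ | ⟨j, hj⟩ | ⟨j, hj⟩ | ⟨j, hj⟩⟩ | _ <;>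
  simp only [toPT_of, val_h, PIOLetter.val_a, PIOLetter.val_b, PIOLetter.val_e,
    PIOLetter.val_f] at h₁ hₙ val_eq <;>
  try grind
  have hᵢ := val_eq i
  have hⱼ := val_eq j
  grind

theorem PIMLetter.of_injective : Function.Injective (of (n := n)) := fun _ _ => of.inj

/-- The relations `N₀`, `N₁` and `N₁'`, whose left-hand sides are the words `h x` with `x = h`,
`x = a_i` and `x = e_i`. -/
def NRel.commRel (n : ℕ) :
    Option (Fin (n - 1) ⊕ Fin (n - 1)) → FreeMonoid (PIMLetter n) × FreeMonoid (PIMLetter n)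
  | none => (FreeMonoid.of .h * FreeMonoid.of .h, 1)
  | some (.inl i) => (FreeMonoid.of .h * FreeMonoid.of (.of (.a (i + 1) (by omega))),
      FreeMonoid.of (.of (.b (n - (i + 1)) (by omega))) * FreeMonoid.of .h)
  | some (.inr i) => (FreeMonoid.of .h * FreeMonoid.of (.of (.e (i + 1) (by omega))),
      FreeMonoid.of (.of (.f (n - (i + 1) + 1) (by omega))) * FreeMonoid.of .h)

theorem NRel.commRel_injective : Function.Injective (commRel n) := by
  intro s t h
  have hleft := congrArg Prod.fst h
  rcases s with _ | i | i <;> rcases t with _ | j | j <;>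
  simp_all [commRel, FreeMonoid.of_injective.eq_iff, Fin.ext_iff]

theorem NRel.setOf_eq (hn : 2 ≤ n) :
    {p : FreeMonoid (PIMLetter n) × FreeMonoid (PIMLetter n) | NRel n p.1 p.2} =
      insert (FreeMonoid.of (.of (.a 1 (by omega))) ^ (n - 1) * FreeMonoid.of .h,
        FreeMonoid.of (.of (.b (n - 1) (by omega))) ^ (n - 1)) (Set.range (commRel n)) := by
  ext ⟨u, v⟩
  constructor
  · rintro (_ | ⟨i, hi, hin⟩ | ⟨i, hi, hin⟩ | _)
    · exact Or.inr ⟨none, rfl⟩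
    · obtain ⟨i, rfl⟩ := Nat.exists_eq_add_of_le' hi
      exact Or.inr ⟨some (.inl ⟨i, by omega⟩), rfl⟩
    · obtain ⟨i, rfl⟩ := Nat.exists_eq_add_of_le' hi
      exact Or.inr ⟨some (.inr ⟨i, by omega⟩), rfl⟩
    · exact Or.inl rfl
  · rintro (h | ⟨_ | i | i, h⟩)
    · exact h ▸ N2 hn
    · exact h ▸ N0
    · exact h ▸ N1 (i + 1) (by omega) (by omega)
    · exact h ▸ N1' (i + 1) (by omega) (by omega)

theorem encard_NRel (hn : 2 ≤ n) :
    {p : FreeMonoid (PIMLetter n) × FreeMonoid (PIMLetter n) | NRel n p.1 p.2}.encard =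
      2 * n := by
  rw [NRel.setOf_eq hn, Set.encard_insert_of_notMem, ← Set.image_univ,
    NRel.commRel_injective.encard_image, Set.encard_univ, ENat.card_eq_coe_fintype_card]
  · simp only [Fintype.card_option, Fintype.card_sum, Fintype.card_fin]
    norm_cast
    omega
  · rintro ⟨s, hs⟩
    have hhead := congrArg (fun p => p.1.toList.head?) hs
    obtain ⟨m, hm⟩ := Nat.exists_eq_add_of_le' (show 1 ≤ n - 1 by omega)
    simp only [hm, pow_succ', mul_assoc] at hhead
    rcases s with _ | i | i <;> simp [NRel.commRel] at hhead

theorem h_mem_of_NRel {u v : FreeMonoid (PIMLetter n)} (h : NRel n u v) : PIMLetter.h ∈ u := by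
  cases h <;> simp [FreeMonoid.mem_mul, FreeMonoid.mem_of]

theorem encard_RHat (hn : 2 ≤ n) (R' : Relations (PIOLetter n)) :
    (RHat n R').encard = R'.encard + 2 * n := by
  have map_of_injective : Function.Injective (FreeMonoid.map (PIMLetter.of (n := n))) :=
    List.map_injective_iff.2 PIMLetter.of_injective
  rw [RHat, Set.encard_union_eq, (map_of_injective.prodMap map_of_injective).encard_image,
    encard_NRel hn]
  rw [Set.disjoint_left]
  rintro _ ⟨⟨u, v⟩, -, rfl⟩ h
  obtain ⟨x, -, hx⟩ := FreeMonoid.mem_map.1 (h_mem_of_NRel h)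
  cases hx

end Counting

section PIORelationsCount

variable {n : ℕ}

/-- The right-hand side of the relation of `PIORelations n` with left-hand side `x y`, if there is
one. -/
def contract : PIOLetter n → PIOLetter n → Option (FreeMonoid (PIOLetter n))
  | .a i _, .a j _ =>
    if i ≤ j then some (if _ : j + 1 < n then wa (j + 1) * wa i else wa i) else none
  | .a i _, .b j _ =>
    if _ : i ≤ j then some (if _ : j + 1 < n then wb (j + 1) * wa (i + 1) else wb i) else none
  | .a i _, .e j _ =>
    if i ≤ j + 1 then
      some (if i ≤ j then if _ : j + 1 < n then we (j + 1) * wa i else wa i else we j)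
    else none
  | .a i _, .f j _ =>
    if i < j then some (if _ : j < n then wf (j + 1) * wa i else wf n * we 1) else none
  | .b i _, .a j _ => if j = 1 then some (wa i) else none
  | .b i _, .b j _ => if j ≤ i then some (if _ : 2 ≤ j then wb (j - 1) * wb i else wb i) else none
  | .b i _, .e j _ =>
    if j ≤ i then some (if _ : 2 ≤ j then we (j - 1) * wb i else wf n * we 1) else none
  | .b i _, .f j _ =>
    if j ≤ i + 2 then
      some (if j ≤ i + 1 then if _ : 3 ≤ j then wf (j - 1) * wb i else wb i else wf j)
    else none
  | .e i _, .a j _ => if i = j then some (we i) else none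
  | .e _ _, .b _ _ => none
  | .e i _, .e j _ => if i ≤ j + 1 then some (if i ≤ j then we i else we j) else none
  | .e i _, .f j _ => if j = i + 1 then some (wa i * wf n) else none
  | .f _ _, .a _ _ => none
  | .f j _, .b i _ => if j = i + 1 then some (wf j) else none
  | .f j _, .e i _ => if j ≤ i + 1 then some (we i * wf j) else none
  | .f j _, .f i _ => if i ≤ j + 1 then some (if i ≤ j then wf j else wf i) else none

theorem PIORel.of_contract_a {i : ℕ} {hi : 1 ≤ i ∧ i < n} {y : PIOLetter n}
    {v : FreeMonoid (PIOLetter n)} (h : v ∈ contract (.a i hi) y) :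
    PIORel n (wa i hi * FreeMonoid.of y) v := by
  rcases y with ⟨j, hj⟩ | ⟨j, hj⟩ | ⟨j, hj⟩ | ⟨j, hj⟩ <;> simp only [contract] at h <;>
    split_ifs at h <;> cases h
  · exact aa i j hi.1 ‹_› ‹_›
  · obtain rfl : j = n - 1 := by omega
    exact aa_last i hi.1 hi.2
  · exact ab i j hi.1 ‹_› ‹_›
  · obtain rfl : j = n - 1 := by omega
    exact ab_last i hi.1 hi.2
  · exact ae i j hi.1 ‹_› ‹_›
  · obtain rfl : j = n - 1 := by omega
    exact ae_last i hi.1 hi.2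
  · obtain rfl : j = i - 1 := by omega
    exact ae_pred i (by omega) hi.2
  · exact af i j hi.1 ‹_› ‹_›
  · obtain rfl : j = n := by omega
    exact af_zero i hi.1 hi.2

theorem PIORel.of_contract_b {i : ℕ} {hi : 1 ≤ i ∧ i < n} {y : PIOLetter n}
    {v : FreeMonoid (PIOLetter n)} (h : v ∈ contract (.b i hi) y) :
    PIORel n (wb i hi * FreeMonoid.of y) v := by
  rcases y with ⟨j, hj⟩ | ⟨j, hj⟩ | ⟨j, hj⟩ | ⟨j, hj⟩ <;> simp only [contract] at h <;>
    split_ifs at h <;> cases h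
  · subst j
    exact ba_first i hi.1 hi.2
  · exact bb i j ‹_› ‹_› hi.2
  · obtain rfl : j = 1 := by omega
    exact bb_first i hi.1 hi.2
  · exact be i j ‹_› ‹_› hi.2
  · obtain rfl : j = 1 := by omega
    exact be_zero i hi.1 hi.2
  · exact bf i j ‹_› ‹_› hi.2
  · obtain rfl : j = 2 := by omega
    exact bf_first i hi.1 hi.2
  · obtain rfl : j = i + 2 := by omega
    exact bf_succ i hi.1 (by omega)

theorem PIORel.of_contract_e {i : ℕ} {hi : 1 ≤ i ∧ i < n} {y : PIOLetter n}
    {v : FreeMonoid (PIOLetter n)} (h : v ∈ contract (.e i hi) y) :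
    PIORel n (we i hi * FreeMonoid.of y) v := by
  rcases y with ⟨j, hj⟩ | ⟨j, hj⟩ | ⟨j, hj⟩ | ⟨j, hj⟩ <;> simp only [contract] at h <;>
    (try split_ifs at h) <;> cases h
  · subst j
    exact ea i hi.1 hi.2
  · exact ee i j hi.1 ‹_› hj.2
  · obtain rfl : i = j + 1 := by omega
    exact ee_succ j (by omega) hi.2
  · subst j
    exact ef_zero i hi.1 hi.2

theorem PIORel.of_contract_f {j : ℕ} {hj : 2 ≤ j ∧ j ≤ n} {y : PIOLetter n}
    {v : FreeMonoid (PIOLetter n)} (h : v ∈ contract (.f j hj) y) :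
    PIORel n (wf j hj * FreeMonoid.of y) v := by
  rcases y with ⟨i, hi⟩ | ⟨i, hi⟩ | ⟨i, hi⟩ | ⟨i, hi⟩ <;> simp only [contract] at h <;>
    (try split_ifs at h) <;> cases h
  · subst j
    exact fb i hi.1 hi.2
  · exact fe i j hj.1 ‹_› hi.2
  · exact ff i j hi.1 ‹_› hj.2
  · obtain rfl : i = j + 1 := by omega
    exact ff_succ j hj.1 (by omega)

theorem PIORel.of_contract {x y : PIOLetter n} {v : FreeMonoid (PIOLetter n)}
    (h : v ∈ contract x y) : PIORel n (FreeMonoid.of x * FreeMonoid.of y) v := by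
  cases x with
  | a => exact of_contract_a h
  | b => exact of_contract_b h
  | e => exact of_contract_e h
  | f => exact of_contract_f h

theorem PIORel.exists_contract_or {u v : FreeMonoid (PIOLetter n)} (h : PIORel n u v) :
    (∃ x y, v ∈ contract x y ∧ FreeMonoid.of x * FreeMonoid.of y = u) ∨
      (∃ hn : 2 ≤ n, wa 1 * (wf n * we 1) = u ∧ wf n * we 1 = v) ∨
      ∃ hn : 2 ≤ n, wb (n - 1) * (wf n * we 1) = u ∧ wf n * we 1 = v := by
  cases h
  case a_zero hn => exact Or.inr (Or.inl ⟨hn, rfl, rfl⟩)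
  case b_zero hn => exact Or.inr (Or.inr ⟨hn, rfl, rfl⟩)
  all_goals
    refine Or.inl ⟨_, _, ?_, rfl⟩
    simp only [contract]
    grind

theorem PIORelations_eq (hn : 2 ≤ n) :
    PIORelations n =
      insert (wa 1 * (wf n * we 1), wf n * we 1)
        (insert (wb (n - 1) * (wf n * we 1), wf n * we 1)
          ((fun p : PIOLetter n × PIOLetter n =>
            (FreeMonoid.of p.1 * FreeMonoid.of p.2, (contract p.1 p.2).getD 1)) ''
            {p | (contract p.1 p.2).isSome})) := by
  ext ⟨u, v⟩
  constructor
  · intro h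
    rcases PIORel.exists_contract_or h with ⟨x, y, hv, rfl⟩ | ⟨-, rfl, rfl⟩ | ⟨-, rfl, rfl⟩
    · refine Or.inr (Or.inr ⟨(x, y), Option.isSome_of_mem hv, ?_⟩)
      simp only [Option.mem_def.1 hv, Option.getD_some]
    · exact Or.inl rfl
    · exact Or.inr (Or.inl rfl)
  · rintro (h | h | ⟨p, hp, h⟩)
    · exact h ▸ PIORel.a_zero hn
    · exact h ▸ PIORel.b_zero hn
    · obtain ⟨w, hw⟩ := Option.isSome_iff_exists.1 hp
      simp only [hw, Option.getD_some] at h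
      exact h ▸ PIORel.of_contract hw

theorem sum_fin_ite_eq (m : ℕ) :
    ∑ i : Fin m, ∑ j : Fin m, (if (i : ℕ) = j then 1 else 0) = m := by
  simp [Fin.val_inj]

theorem sum_fin_ite_succ_eq_one (m : ℕ) :
    ∑ _i : Fin m, ∑ j : Fin m, (if (j : ℕ) + 1 = 1 then 1 else 0) = m := by
  cases m <;> simp

theorem sum_fin_ite_eq_succ (m : ℕ) :
    ∑ i : Fin m, ∑ j : Fin m, (if (i : ℕ) = j + 1 then 1 else 0) = m - 1 := by
  cases m with
  | zero => rfl
  | succ m =>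
    have hrow (i : Fin m) : ∑ j : Fin (m + 1), (if (i : ℕ) = j then 1 else 0) = 1 := by
      simp [← Fin.val_castSucc i, Fin.val_inj, -Fin.val_castSucc]
    rw [Fin.sum_univ_succ]
    simp only [Fin.val_succ, Fin.val_zero, Nat.add_right_cancel_iff, hrow]
    simp

theorem two_mul_sum_fin_ite_le (m : ℕ) :
    2 * ∑ i : Fin m, ∑ j : Fin m, (if (i : ℕ) ≤ j then 1 else 0) = m * (m + 1) := by
  have htotal (i j : ℕ) : (if i ≤ j then 1 else 0) + (if j ≤ i then 1 else 0) =
      1 + if i = j then 1 else 0 := by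
    grind
  calc
    _ = ∑ i : Fin m, ∑ j : Fin m,
        ((if (i : ℕ) ≤ j then 1 else 0) + if (j : ℕ) ≤ i then 1 else 0) := by
      simp only [Finset.sum_add_distrib]
      rw [two_mul, Finset.sum_comm (f := fun i j : Fin m => if (j : ℕ) ≤ i then 1 else 0)]
    _ = m * (m + 1) := by
      simp only [htotal, Finset.sum_add_distrib, sum_fin_ite_eq, Finset.sum_const,
        Finset.card_univ, Fintype.card_fin, smul_eq_mul]
      ring

theorem sum_fin_ite_le_succ (m : ℕ) :
    ∑ i : Fin m, ∑ j : Fin m, (if (i : ℕ) ≤ j + 1 then 1 else 0) =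
      ∑ i : Fin m, ∑ j : Fin m, (if (i : ℕ) ≤ j then 1 else 0) + (m - 1) := by
  have hsplit (i j : ℕ) : (if i ≤ j + 1 then 1 else 0) =
      (if i ≤ j then 1 else 0) + if i = j + 1 then 1 else 0 := by
    grind
  simp only [hsplit, Finset.sum_add_distrib, sum_fin_ite_eq_succ]

theorem sum_isSome_contract (hn : 2 ≤ n) :
    ∑ x : PIOLetter n, ∑ y : PIOLetter n, (if (contract x y).isSome then 1 else 0) =
      5 * n ^ 2 + 3 * n - 12 := by
  have hge := Finset.sum_comm (s := Finset.univ) (t := Finset.univ)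
    (f := fun i j : Fin (n - 1) => if (j : ℕ) ≤ i then 1 else 0)
  have hge' := Finset.sum_comm (s := Finset.univ) (t := Finset.univ)
    (f := fun i j : Fin (n - 1) => if (j : ℕ) ≤ i + 1 then 1 else 0)
  have heq := Finset.sum_comm (s := Finset.univ) (t := Finset.univ)
    (f := fun i j : Fin (n - 1) => if (j : ℕ) = i then 1 else 0)
  have hle := two_mul_sum_fin_ite_le (n - 1)
  have hpoly : 5 * n ^ 2 + 3 * n - 12 =
      5 * ((n - 1) * (n - 1 + 1)) + 4 * (n - 1) + 4 * (n - 1 - 1) := by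
    obtain ⟨m, rfl⟩ := Nat.exists_eq_add_of_le' hn
    rw [Nat.sub_eq_iff_eq_add (by lia)]
    simp only [show m + 2 - 1 = m + 1 from rfl, Nat.add_sub_cancel]
    ring
  rw [hpoly, ← hle]
  simp only [PIOLetter.sum_eq, contract, apply_dite Option.isSome, apply_ite Option.isSome,
    Option.isSome_some, Option.isSome_none, Bool.ite_eq_true_distrib, Bool.false_eq_true,
    if_false_right, dite_eq_ite, if_false, Finset.sum_add_distrib, Nat.add_le_add_iff_right,
    Nat.add_right_cancel_iff, and_true, Nat.lt_add_one_iff, hge, hge', heq,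
    sum_fin_ite_succ_eq_one, Finset.sum_const_zero, sum_fin_ite_le_succ, sum_fin_ite_eq]
  omega

theorem ncard_PIORelations (hn : 2 ≤ n) :
    (PIORelations n).ncard = 5 * n ^ 2 + 3 * n - 10 := by
  have hinj : Function.Injective fun p : PIOLetter n × PIOLetter n =>
      (FreeMonoid.of p.1 * FreeMonoid.of p.2, (contract p.1 p.2).getD 1) := by
    rintro ⟨x, y⟩ ⟨x', y'⟩ h
    have hwords := congrArg (fun p => FreeMonoid.toList p.1) h
    simpa using hwords
  have hsq : 2 * n ≤ n ^ 2 := by nlinarith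
  rw [PIORelations_eq hn, Set.ncard_insert_of_notMem, Set.ncard_insert_of_notMem,
    Set.ncard_image_of_injective _ hinj, Set.ncard_eq_toFinset_card', Set.toFinset_ofPred,
    Finset.card_filter, Fintype.sum_prod_type, sum_isSome_contract hn]
  · omega
  · rintro ⟨p, -, h⟩
    simpa [wb, wf, we] using congrArg (fun p => FreeMonoid.length p.1) h
  · rintro (h | ⟨p, -, h⟩)
    · simpa [wa, wb] using congrArg (fun p => p.1.toList.head?) h
    · simpa [wa, wf, we] using congrArg (fun p => FreeMonoid.length p.1) h

theorem ncard_RHat_PIORelations (hn : 2 ≤ n) :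
    (RHat n (PIORelations n)).ncard = 5 * n ^ 2 + 5 * n - 10 := by
  have hcard := ncard_PIORelations hn
  have hsq : 2 * n ≤ n ^ 2 := by nlinarith
  have hfin : (PIORelations n).Finite := Set.finite_of_ncard_ne_zero (by omega)
  have hencard : (RHat n (PIORelations n)).encard = ((PIORelations n).ncard + 2 * n : ℕ) := by
    rw [encard_RHat hn, ← hfin.cast_ncard_eq]
    norm_cast
  rw [Set.ncard, hencard, ENat.toNat_natCast, hcard]
  omega

end PIORelationsCount

theorem theorem9 (n : ℕ) (hn : 2 ≤ n) :
    -- the alphabet has `4n - 3` letters, which denote pairwise distinct transformations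
    Nat.card (PIMLetter n) = 4 * n - 3 ∧
    Function.Injective (PIMLetter.toPT (n := n)) ∧
    -- every presentation of `PIOn n` on the letters `a_i, b_i, e_i, f_j` extends to one of `PIMn n`
    (∀ R' : Relations (PIOLetter n), DefinedBy (PIOn n) PIOLetter.toPT R' →
      DefinedBy (PIMn n) PIMLetter.toPT (RHat n R') ∧
      (RHat n R').encard = R'.encard + 2 * n) ∧
    -- the explicit presentation of `PIOn n`, and the resulting presentation of `PIMn n`
    DefinedBy (PIOn n) PIOLetter.toPT (PIORelations n) ∧
    (PIORelations n).ncard = 5 * n ^ 2 + 3 * n - 10 ∧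
    DefinedBy (PIMn n) PIMLetter.toPT (RHat n (PIORelations n)) ∧
    (RHat n (PIORelations n)).ncard = 5 * n ^ 2 + 5 * n - 10 :=
  ⟨PIMLetter.nat_card hn, PIMLetter.toPT_injective hn,
    fun R' hR => ⟨definedBy_RHat hn hR, encard_RHat hn R'⟩,
    definedBy_PIORelations hn, ncard_PIORelations hn,
    definedBy_RHat hn (definedBy_PIORelations hn), ncard_RHat_PIORelations hn⟩
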